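/- Let $G=(X,\sim)$ be an infinite, connected, locally finite simple graph (unweighted, equipped with the counting measure), let $d$ be its natural graph distance, i.e. $d(x,y)$ is the least number of edges of a path from $x$ to $y$, fix $x_0\in X$, and for real $r\ge 0$ let $B_r^d=\{x\in X: d(x,x_0)\le r\}$. Let $\Delta$ be the graph Laplacian on the real Hilbert space $\ell^2(X)$, that is, the operator $$\Delta\varphi(x)=\sum_{y\sim x}\bigl(\varphi(x)-\varphi(y)\bigr),\qquad D(\Delta)=\Bigl\{\varphi\in\ell^2(X): \bigl(x\mapsto \sum_{y\sim x}(\varphi(x)-\varphi(y))\bigr)\in\ell^2(X)\Bigr\}.$$ Let $\sigma(\Delta)\subseteq\mathbb R$ be its spectrum and $\sigma_{\mathrm{ess}}(\Delta)$ its essential spectrum, i.e. the set of all points of $\sigma(\Delta)$ that are not isolated points of $\sigma(\Delta)$ which are eigenvalues of finite multiplicity. Put $\lambda_0(\Delta)=\inf\sigma(\Delta)$ and $\lambda_0^{\mathrm{ess}}(\Delta)=\inf\sigma_{\mathrm{ess}}(\Delta)$ in $[-\infty,\infty]$, with $\inf\emptyset=\infty$. If $$\liminf_{r\to\infty}\frac{\log|B_r^d|}{\log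 r}<3,$$ then $\lambda_0(\Delta)=\lambda_0^{\mathrm{ess}}(\Delta)=0$. Moreover, if $$\limsup_{r\to\infty}\frac{|B_r^d|}{r^3}<\infty,$$ then $\lambda_0^{\mathrm{ess}}(\Delta)<\infty$ and, in particular, $\sigma_{\mathrm{ess}}(\Delta)\neq\emptyset$. -/

import Mathlib

open Filter Topology
open scoped ENNReal

noncomputable section

/-! ### Spectrum of an unbounded operator on a real Hilbert space -/

section Spectrum

variable {E : Type*} [NormedAddCommGroup E] [InnerProductSpace ℝ E]

/-- The resolvent set of a (possibly unbounded) operator `T`: the real numbers `l` for which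
`T - l`, as a map from the domain of `T` to `E`, has an everywhere defined bounded inverse `S`. -/
def resolventSetPMap (T : E →ₗ.[ℝ] E) : Set ℝ :=
  {l | ∃ S : E →L[ℝ] E,
    (∀ y : E, ∃ hy : S y ∈ T.domain, T ⟨S y, hy⟩ - l • S y = y) ∧
    (∀ x : T.domain, S (T x - l • (x : E)) = x)}

/-- The spectrum of `T`: the complement of the resolvent set. -/
def spectrumPMap (T : E →ₗ.[ℝ] E) : Set ℝ := (resolventSetPMap T)ᶜ

/-- The eigenspace `{x ∈ D(T) | T x = l x}`, as a subspace of the domain of `T`. -/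
def eigenspacePMap (T : E →ₗ.[ℝ] E) (l : ℝ) : Submodule ℝ T.domain :=
  LinearMap.ker (T.toFun - l • T.domain.subtype)

/-- The discrete spectrum: isolated points of the spectrum that are eigenvalues of
finite multiplicity. -/
def discreteSpectrumPMap (T : E →ₗ.[ℝ] E) : Set ℝ :=
  {l | l ∈ spectrumPMap T ∧
    (∃ ε > 0, ∀ l' ∈ spectrumPMap T, |l' - l| < ε → l' = l) ∧
    eigenspacePMap T l ≠ ⊥ ∧ FiniteDimensional ℝ (eigenspacePMap T l)}

/-- The essential spectrum: the complement of the discrete spectrum in the spectrum. -/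
def essentialSpectrumPMap (T : E →ₗ.[ℝ] E) : Set ℝ :=
  spectrumPMap T \ discreteSpectrumPMap T

/-- The bottom of the spectrum, as an extended real number (`inf ∅ = ∞`). -/
def bottomSpectrum (T : E →ₗ.[ℝ] E) : EReal :=
  sInf ((fun l : ℝ => (l : EReal)) '' spectrumPMap T)

/-- The bottom of the essential spectrum, as an extended real number (`inf ∅ = ∞`). -/
def bottomEssentialSpectrum (T : E →ₗ.[ℝ] E) : EReal :=
  sInf ((fun l : ℝ => (l : EReal)) '' essentialSpectrumPMap T)

end Spectrum

/-! ### The graph Laplacian -/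

section GraphLaplacian

variable {X : Type*} (G : SimpleGraph X) [G.LocallyFinite]

/-- The formal graph Laplacian `φ ↦ (x ↦ ∑_{y ∼ x} (φ x - φ y))` on all functions. -/
def formalLaplacian : (X → ℝ) →ₗ[ℝ] (X → ℝ) where
  toFun φ x := ∑ y ∈ G.neighborFinset x, (φ x - φ y)
  map_add' φ ψ := by
    funext x
    simp only [Pi.add_apply, ← Finset.sum_add_distrib]
    exact Finset.sum_congr rfl fun y _ => by ring
  map_smul' c φ := by
    funext x
    simp only [Pi.smul_apply, smul_eq_mul, RingHom.id_apply, Finset.mul_sum, mul_sub]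

/-- The graph Laplacian on the real Hilbert space `ℓ²(X)` (counting measure), with domain the
set of all `φ ∈ ℓ²(X)` for which `x ↦ ∑_{y ∼ x} (φ x - φ y)` is again in `ℓ²(X)`. -/
def graphLaplacian : lp (fun _ : X => ℝ) 2 →ₗ.[ℝ] lp (fun _ : X => ℝ) 2 where
  domain :=
    { carrier := {φ | Memℓp (formalLaplacian G (φ : X → ℝ)) 2}
      zero_mem' := by
        simp only [Set.mem_ofPred_eq, lp.coeFn_zero, map_zero]
        exact zero_memℓp
      add_mem' := fun {φ ψ} hφ hψ => by
        simp only [Set.mem_ofPred_eq, lp.coeFn_add, map_add] at *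
        exact hφ.add hψ
      smul_mem' := fun c φ hφ => by
        simp only [Set.mem_ofPred_eq, lp.coeFn_smul, map_smul] at *
        exact hφ.const_smul c }
  toFun :=
    { toFun := fun φ => ⟨formalLaplacian G (φ.1 : X → ℝ), φ.2⟩
      map_add' := fun φ ψ => by
        apply Subtype.ext
        exact map_add (formalLaplacian G) (φ.1 : X → ℝ) (ψ.1 : X → ℝ)
      map_smul' := fun c φ => by
        apply Subtype.ext
        exact map_smul (formalLaplacian G) c (φ.1 : X → ℝ) }

end GraphLaplacian

/-- The closed ball of real radius `r` about `x₀` in the natural graph distance. -/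
def graphBall {X : Type*} (G : SimpleGraph X) (x₀ : X) (r : ℝ) : Set X :=
  {x | (G.dist x x₀ : ℝ) ≤ r}

end

/-! Both claims come from Rayleigh quotients of radial cutoffs, so that only sphere and ball sizes
enter. Let v(n) and s_n be the sizes of the ball and the sphere of radius n. At most s_n s_{n+1}
edges join consecutive spheres, and at least half of the radii n in [a, 2a) satisfy s_n + s_{n+1} ≤
4v(2a)/a. A function falling from 1 to 0 in equal steps at these radii has energy of order v(2a)²/a³
(`exists_cutoff`); setting it to zero on a fixed ball costs a constant independent of a. A lower
bound λ for the form outside the ball of radius m thus gives λ(v(a) - v(m)) ≤ C + 16 v(2a)²/a³.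

If 0 is in the resolvent set, such a λ > 0 exists, and iteration over dyadic radii yields v(n) ≥ c
n³ (`exists_pow_three_le_of_poincare`), which excludes a lower limit below 3. Since 0 is not an ℓ²
eigenvalue, it then lies in the essential spectrum, while negative numbers lie in the resolvent set.
If the essential spectrum were empty, λ could be taken arbitrarily large outside suitable balls;
under v(n) ≤ C₀n³ this forces v(2a) ≥ 9v(a) for large a, more than the factor 2³ = 8 of cubic growth
(`not_poincare_of_le_pow_three`).

The spectrum is linked to the form through the bounded resolvent S = (1 + kΔ)⁻¹ = j j*, where j
includes the form domain into ℓ². Resolvent points of Δ become lower bounds for S - t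
(`IsInverseOneAdd.boundedBelow_sub`), and elementary quadratic form arguments play the role of the
spectral theorem. -/

section SymmetricOperators

/-! ### Bounded symmetric operators: spectral gaps and forms. -/

variable {E : Type*} [NormedAddCommGroup E] [InnerProductSpace ℝ E]

/-- A bounded operator which is bounded below. -/
def BoundedBelow (A : E →L[ℝ] E) : Prop := ∃ c > 0, ∀ x, c * ‖x‖ ≤ ‖A x‖

theorem BoundedBelow.comp {A B : E →L[ℝ] E} (hA : BoundedBelow A) (hB : BoundedBelow B) :
    BoundedBelow (A ∘L B) := by
  obtain ⟨a, ha, hA⟩ := hA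
  obtain ⟨b, hb, hB⟩ := hB
  refine ⟨a * b, mul_pos ha hb, fun x => ?_⟩
  calc a * b * ‖x‖ = a * (b * ‖x‖) := by ring
    _ ≤ a * ‖B x‖ := by gcongr; exact hB x
    _ ≤ ‖A (B x)‖ := hA _

/-- Cauchy–Schwarz for the form of a symmetric operator that is nonnegative on a subspace. -/
theorem inner_sq_le_of_nonneg_on (A : E →L[ℝ] E)
    (hA : ∀ x y, inner ℝ (A x) y = inner ℝ x (A y)) (P : Submodule ℝ E)
    (hP : ∀ x ∈ P, 0 ≤ inner ℝ (A x) x) {x z : E} (hx : x ∈ P) (hz : z ∈ P) :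
    inner ℝ (A x) z ^ 2 ≤ inner ℝ (A x) x * inner ℝ (A z) z := by
  have key : ∀ t : ℝ, 0 ≤ inner ℝ (A z) z * (t * t) + 2 * inner ℝ (A x) z * t + inner ℝ (A x) x := by
    intro t
    have h := hP (x + t • z) (P.add_mem hx (P.smul_mem t hz))
    have h2 : inner ℝ (A z) x = inner ℝ (A x) z := by rw [hA z x, real_inner_comm]
    simp only [map_add, map_smul, inner_add_left, inner_add_right, real_inner_smul_left,
      real_inner_smul_right, h2] at h
    linarith
  have := discrim_le_zero key
  rw [discrim] at this
  nlinarith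

/-- Cauchy–Schwarz for the form of `A`, tested against `A x` itself. -/
theorem norm_sq_le_of_nonneg (A : E →L[ℝ] E)
    (hA : ∀ x y, inner ℝ (A x) y = inner ℝ x (A y)) (hP : ∀ x, 0 ≤ inner ℝ (A x) x) (x : E) :
    ‖A x‖ ^ 2 ≤ ‖A‖ * inner ℝ (A x) x := by
  have h := inner_sq_le_of_nonneg_on A hA ⊤ (fun x _ => hP x) (Submodule.mem_top (x := x))
    (Submodule.mem_top (x := A x))
  rw [real_inner_self_eq_norm_sq] at h
  have h2 : inner ℝ (A (A x)) (A x) ≤ ‖A‖ * ‖A x‖ ^ 2 := by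
    calc _ ≤ ‖A (A x)‖ * ‖A x‖ := real_inner_le_norm _ _
      _ ≤ (‖A‖ * ‖A x‖) * ‖A x‖ := by gcongr; exact A.le_opNorm _
      _ = _ := by ring
  rcases (sq_nonneg ‖A x‖).eq_or_lt with h0 | h0
  · rw [← h0]; exact mul_nonneg (norm_nonneg _) (hP x)
  · have h3 : (‖A x‖ ^ 2) * ‖A x‖ ^ 2 ≤ (‖A‖ * inner ℝ (A x) x) * ‖A x‖ ^ 2 := by
      nlinarith [mul_le_mul_of_nonneg_left h2 (hP x)]
    exact le_of_mul_le_mul_right h3 h0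

/-- A nonnegative operator that is bounded below has a positive lower bound. -/
theorem exists_pos_le_inner_of_boundedBelow (A : E →L[ℝ] E)
    (hA : ∀ x y, inner ℝ (A x) y = inner ℝ x (A y)) (hP : ∀ x, 0 ≤ inner ℝ (A x) x)
    (hb : BoundedBelow A) : ∃ c > 0, ∀ x, c * ‖x‖ ^ 2 ≤ inner ℝ (A x) x := by
  obtain ⟨c, hc, h⟩ := hb
  refine ⟨c ^ 2 / (‖A‖ + 1), by positivity, fun x => ?_⟩
  rw [div_mul_eq_mul_div, div_le_iff₀ (by positivity)]
  have h1 := norm_sq_le_of_nonneg A hA hP x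
  have h2 : (c * ‖x‖) ^ 2 ≤ ‖A x‖ ^ 2 := by gcongr; exact h x
  nlinarith [hP x]

/-- If `B - t` is bounded below for all `t` in the gap `(0, δ)` then `B² - δ B ≥ 0`. -/
theorem mul_inner_le_norm_sq_of_gap (B : E →L[ℝ] E)
    (hB : ∀ x y, inner ℝ (B x) y = inner ℝ x (B y)) {δ : ℝ} (hδ : 0 < δ)
    (hgap : ∀ t, 0 < t → t < δ → BoundedBelow (B - t • ContinuousLinearMap.id ℝ E)) (x : E) :
    δ * inner ℝ (B x) x ≤ ‖B x‖ ^ 2 := by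
  by_contra! hx
  have hx0 : x ≠ 0 := by rintro rfl; simp at hx
  -- Suppose the infimum `m` of the form of `B² - δB` on the unit sphere is negative. Then `-δ²/4 ≤
  -- m < 0`, both roots of `λ² - δλ - m` lie in `(0, δ)`, and the product `D` of the factors `B -
  -- root` is bounded below. So `D = B² - δB - m` has a positive lower bound, against the choice of
  -- `m`.
  set R : Set ℝ := {r | ∃ y : E, ‖y‖ = 1 ∧ r = ‖B y‖ ^ 2 - δ * inner ℝ (B y) y} with hR
  have hbelow : ∀ r ∈ R, -(δ ^ 2 / 4) ≤ r := by
    rintro r ⟨y, hy, rfl⟩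
    have h1 : inner ℝ (B y) y ≤ ‖B y‖ := by simpa [hy] using real_inner_le_norm (B y) y
    nlinarith [sq_nonneg (‖B y‖ - δ / 2)]
  have hnx : 0 < ‖x‖ := norm_pos_iff.2 hx0
  have hmem : ∀ y : E, y ≠ 0 → (‖B y‖ ^ 2 - δ * inner ℝ (B y) y) / ‖y‖ ^ 2 ∈ R := by
    intro y hy
    have hny : ‖y‖ ≠ 0 := norm_ne_zero_iff.2 hy
    refine ⟨‖y‖⁻¹ • y, by simp [norm_smul, hny], ?_⟩
    simp only [map_smul, norm_smul, real_inner_smul_left, real_inner_smul_right, norm_inv, norm_norm]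
    field_simp
  have hbdd : BddBelow R := ⟨_, hbelow⟩
  set m := sInf R with hm
  have hmle : ∀ y : E, m * ‖y‖ ^ 2 ≤ ‖B y‖ ^ 2 - δ * inner ℝ (B y) y := by
    intro y
    rcases eq_or_ne y 0 with rfl | hy
    · simp
    · have := csInf_le hbdd (hmem y hy)
      rwa [le_div_iff₀ (by have := norm_pos_iff.2 hy; positivity)] at this
  have hm0 : m < 0 := by nlinarith [hmle x, sq_pos_of_pos hnx]
  have hm4 : -(δ ^ 2 / 4) ≤ m := le_csInf ⟨_, hmem x hx0⟩ hbelow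
  set s := Real.sqrt (δ ^ 2 + 4 * m) with hs
  have hs2 : s ^ 2 = δ ^ 2 + 4 * m := Real.sq_sqrt (by linarith)
  have hs0 : 0 ≤ s := Real.sqrt_nonneg _
  have hsδ : s < δ := by nlinarith
  have h1 := hgap ((δ + s) / 2) (by linarith) (by linarith)
  have h2 := hgap ((δ - s) / 2) (by linarith) (by linarith)
  have h3 := h1.comp h2
  have hin : ∀ y, inner ℝ (B (B y)) y = ‖B y‖ ^ 2 := fun y => by
    rw [hB, real_inner_self_eq_norm_sq]
  have hform : ∀ y, ((B - ((δ + s) / 2) • ContinuousLinearMap.id ℝ E) ∘L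
      (B - ((δ - s) / 2) • ContinuousLinearMap.id ℝ E)) y = B (B y) - δ • B y - m • y := by
    intro y
    have : m = (s ^ 2 - δ ^ 2) / 4 := by linarith
    rw [this]
    simp only [ContinuousLinearMap.comp_apply, _root_.sub_apply, map_sub, map_smul,
      _root_.smul_apply, ContinuousLinearMap.id_apply]
    module
  set D := ((B - ((δ + s) / 2) • ContinuousLinearMap.id ℝ E) ∘L
      (B - ((δ - s) / 2) • ContinuousLinearMap.id ℝ E))
  have hDin : ∀ y, inner ℝ (D y) y = ‖B y‖ ^ 2 - δ * inner ℝ (B y) y - m * ‖y‖ ^ 2 := by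
    intro y
    rw [hform, inner_sub_left, inner_sub_left, hin, real_inner_smul_left, real_inner_smul_left,
      real_inner_self_eq_norm_sq]
  obtain ⟨c, hc, hcD⟩ := exists_pos_le_inner_of_boundedBelow D
    (fun y z => by
      simp only [hform, inner_sub_left, inner_sub_right, real_inner_smul_left,
        real_inner_smul_right, hB])
    (fun y => by rw [hDin]; linarith [hmle y]) h3
  obtain ⟨r, ⟨y, hy, rfl⟩, hr⟩ := exists_lt_of_csInf_lt ⟨_, hmem x hx0⟩
    (show sInf R < m + c by linarith)
  have := hcD y
  rw [hDin, hy] at this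
  linarith

/-- If the punctured interval `(-δ, δ) \ {0}` contains no approximate eigenvalue of `A`, then
`A` is bounded below by `δ` on the orthogonal complement of its kernel. -/
theorem le_norm_of_mem_ker_orthogonal [CompleteSpace E] (A : E →L[ℝ] E)
    (hA : ∀ x y, inner ℝ (A x) y = inner ℝ x (A y)) {δ : ℝ} (hδ : 0 < δ)
    (hgap : ∀ t, t ≠ 0 → |t| < δ → BoundedBelow (A - t • ContinuousLinearMap.id ℝ E))
    {y : E} (hy : y ∈ (LinearMap.ker (A : E →ₗ[ℝ] E))ᗮ) : δ * ‖y‖ ≤ ‖A y‖ := by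
  -- `A² - t = (A - √t)(A + √t)`, so `A²` has the gap `(0, δ²)`. This yields the bound on the range
  -- of `A`, whose closure is the complement of the kernel.
  have hgap2 : ∀ t, 0 < t → t < δ ^ 2 →
      BoundedBelow (A ∘L A - t • ContinuousLinearMap.id ℝ E) := by
    intro t ht htδ
    have hs := Real.sqrt_pos.2 ht
    have hsδ : Real.sqrt t < δ := (Real.sqrt_lt' hδ).2 htδ
    have h := (hgap (Real.sqrt t) hs.ne' (by rwa [abs_of_pos hs])).comp
      (hgap (-Real.sqrt t) (by linarith) (by rwa [abs_neg, abs_of_pos hs]))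
    convert h using 1
    ext z
    simp only [ContinuousLinearMap.comp_apply, _root_.sub_apply, map_sub, map_smul,
      _root_.smul_apply, ContinuousLinearMap.id_apply]
    nth_rewrite 1 [← Real.mul_self_sqrt ht.le]
    module
  have hrange : ∀ z, δ * ‖A z‖ ≤ ‖A (A z)‖ := by
    intro z
    have h := mul_inner_le_norm_sq_of_gap (A ∘L A)
      (fun x y => by simp only [ContinuousLinearMap.comp_apply, hA]) (pow_pos hδ 2) hgap2 z
    simp only [ContinuousLinearMap.comp_apply] at h
    rw [hA, real_inner_self_eq_norm_sq] at h
    exact le_of_sq_le_sq (by rw [mul_pow]; exact h) (norm_nonneg _)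
  have hadj : ContinuousLinearMap.adjoint A = A :=
    ((ContinuousLinearMap.eq_adjoint_iff A A).2 hA).symm
  have hcl : y ∈ closure (Set.range A) := by
    have := ContinuousLinearMap.orthogonal_ker A
    rw [hadj] at this
    rw [this] at hy
    exact hy
  have hclosed : IsClosed {z : E | δ * ‖z‖ ≤ ‖A z‖} :=
    isClosed_le (by fun_prop) (by fun_prop)
  exact closure_minimal (by rintro _ ⟨z, rfl⟩; exact hrange z) hclosed hcl

/-- A nonnegative bounded operator without singular Weyl sequences at positive points is small
on a subspace of finite codimension. -/
theorem exists_finiteDimensional_inner_le (S : E →L[ℝ] E)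
    (hS : ∀ x y, inner ℝ (S x) y = inner ℝ x (S y)) (hpos : ∀ x, 0 ≤ inner ℝ (S x) x)
    (hgood : ∀ μ : ℝ, 0 < μ → ∃ W : Submodule ℝ E, FiniteDimensional ℝ W ∧ ∃ η : ℝ, 0 < η ∧ ∀ y ∈ Wᗮ,
      η * ‖y‖ ≤ ‖S y - μ • y‖) {ε : ℝ} (hε : 0 < ε) :
    ∃ V : Submodule ℝ E, FiniteDimensional ℝ V ∧ ∀ y ∈ Vᗮ, inner ℝ (S y) y ≤ ε * ‖y‖ ^ 2 := by
  set M : Set ℝ := {m | 0 ≤ m ∧ ∃ V : Submodule ℝ E, FiniteDimensional ℝ V ∧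
    ∀ y ∈ Vᗮ, inner ℝ (S y) y ≤ m * ‖y‖ ^ 2} with hM
  have hne : M.Nonempty := by
    refine ⟨‖S‖, norm_nonneg _, ⊥, inferInstance, fun y _ => ?_⟩
    calc _ ≤ ‖S y‖ * ‖y‖ := real_inner_le_norm _ _
      _ ≤ (‖S‖ * ‖y‖) * ‖y‖ := by gcongr; exact S.le_opNorm _
      _ = _ := by ring
  have hbdd : BddBelow M := ⟨0, fun m hm => hm.1⟩
  -- `μ` acts as the top of the essential spectrum of `S`. If it were positive, `μ` would have
  -- approximate eigenvectors orthogonal to the `W` given by `hgood`.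
  set μ := sInf M with hμ
  rcases lt_or_ge μ ε with hlt | hge
  · obtain ⟨m, ⟨-, V, hV, h⟩, hm⟩ := exists_lt_of_csInf_lt hne hlt
    exact ⟨V, hV, fun y hy => (h y hy).trans (by gcongr)⟩
  exfalso
  have hμ0 : 0 < μ := hε.trans_le hge
  obtain ⟨W, hW, η, hη, hWη⟩ := hgood μ hμ0
  obtain ⟨δ, hδ0, hδμ, hδη, hδη2⟩ : ∃ δ > 0, δ ≤ μ ∧ δ ≤ η / 4 ∧ 2 * δ * (μ + δ) ≤ (η / 4) ^ 2 := by
    refine ⟨min μ (min (η / 4) ((η / 4) ^ 2 / (4 * μ))), by positivity, min_le_left _ _,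
      (min_le_right _ _).trans (min_le_left _ _), ?_⟩
    set δ := min μ (min (η / 4) ((η / 4) ^ 2 / (4 * μ)))
    have h1 : δ ≤ μ := min_le_left _ _
    have h2 : δ ≤ (η / 4) ^ 2 / (4 * μ) := (min_le_right _ _).trans (min_le_right _ _)
    rw [le_div_iff₀ (by positivity)] at h2
    have h3 : 0 < δ := by positivity
    nlinarith
  obtain ⟨m, ⟨-, V0, hV0, h0⟩, hm⟩ := exists_lt_of_csInf_lt hne (show sInf M < μ + δ by linarith)
  have hnot : μ - δ ∉ M := fun h => by have := csInf_le hbdd h; linarith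
  set V := V0 ⊔ W with hV
  -- Adjoining `S V` keeps `S y`, hence `A y` for `A = μ + δ - S`, orthogonal to `V`, where `A` is
  -- nonnegative. As the form of `A` at `y` is at most `2δ‖y‖²`, Cauchy–Schwarz makes `A y` small.
  set U := V ⊔ V.map (S : E →ₗ[ℝ] E) with hU
  have : ∃ y ∈ Uᗮ, (μ - δ) * ‖y‖ ^ 2 < inner ℝ (S y) y := by
    by_contra! h
    exact hnot ⟨by linarith, U, inferInstance, h⟩
  obtain ⟨y, hyU, hy⟩ := this
  have hyV : y ∈ Vᗮ := Submodule.orthogonal_le le_sup_left hyU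
  have hSyV : S y ∈ Vᗮ := by
    rw [Submodule.mem_orthogonal]
    intro v hv
    rw [← hS]
    exact (Submodule.mem_orthogonal _ _).1 hyU _
      ((le_sup_right : _ ≤ U) (Submodule.mem_map_of_mem hv))
  have hyW : y ∈ Wᗮ := Submodule.orthogonal_le le_sup_right hyV
  set A : E →L[ℝ] E := (μ + δ) • ContinuousLinearMap.id ℝ E - S with hA
  have hAap : ∀ x, A x = (μ + δ) • x - S x := fun x => by simp [hA]
  have hAin : ∀ x, inner ℝ (A x) x = (μ + δ) * ‖x‖ ^ 2 - inner ℝ (S x) x := fun x => by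
    rw [hAap, inner_sub_left, real_inner_smul_left, real_inner_self_eq_norm_sq]
  have hzV : A y ∈ Vᗮ := by
    rw [hAap]; exact Submodule.sub_mem _ (Submodule.smul_mem _ _ hyV) hSyV
  have hApos : ∀ x ∈ Vᗮ, 0 ≤ inner ℝ (A x) x := fun x hx => by
    rw [hAin]
    have h1 := h0 x (Submodule.orthogonal_le le_sup_left hx)
    have : m * ‖x‖ ^ 2 ≤ (μ + δ) * ‖x‖ ^ 2 := by gcongr
    linarith
  have hcs := inner_sq_le_of_nonneg_on A
    (fun x z => by simp only [hAap, inner_sub_left, inner_sub_right, real_inner_smul_left,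
      real_inner_smul_right, hS]) Vᗮ hApos hyV hzV
  rw [real_inner_self_eq_norm_sq] at hcs
  have h1 : inner ℝ (A y) y ≤ 2 * δ * ‖y‖ ^ 2 := by rw [hAin]; linarith
  have h2 : inner ℝ (A (A y)) (A y) ≤ (μ + δ) * ‖A y‖ ^ 2 := by
    rw [hAin]; linarith [hpos (A y)]
  have hny : 0 < ‖y‖ := by
    rw [norm_pos_iff]; rintro rfl; simp at hy
  have h3 : ‖A y‖ ≤ η / 4 * ‖y‖ := by
    by_contra! hlt
    have hz : 0 < ‖A y‖ := lt_of_le_of_lt (by positivity) hlt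
    have h4 : (‖A y‖ ^ 2) ^ 2 ≤ (2 * δ * ‖y‖ ^ 2) * ((μ + δ) * ‖A y‖ ^ 2) :=
      hcs.trans (mul_le_mul h1 h2 (hApos _ hzV) (by positivity))
    have h5 : ‖A y‖ ^ 2 ≤ 2 * δ * (μ + δ) * ‖y‖ ^ 2 := by
      have : 0 < ‖A y‖ ^ 2 := by positivity
      nlinarith
    have h6 : (η / 4 * ‖y‖) ^ 2 < ‖A y‖ ^ 2 := by gcongr
    have h7 : 2 * δ * (μ + δ) * ‖y‖ ^ 2 ≤ (η / 4) ^ 2 * ‖y‖ ^ 2 := by gcongr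
    nlinarith
  have h4 := hWη y hyW
  have h5 : S y - μ • y = δ • y - A y := by rw [hAap]; module
  have h6 : ‖S y - μ • y‖ ≤ δ * ‖y‖ + ‖A y‖ := by
    rw [h5]
    refine (norm_sub_le _ _).trans ?_
    rw [norm_smul, Real.norm_of_nonneg hδ0.le]
  have h7 : δ * ‖y‖ ≤ η / 4 * ‖y‖ := by gcongr
  nlinarith

end SymmetricOperators

/-! ### Transfer between an unbounded operator and its resolvent. -/

section UnboundedOperators

variable {E : Type*} [NormedAddCommGroup E] [InnerProductSpace ℝ E]

/-- `S` is the inverse of `1 + k T`. -/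
structure IsInverseOneAdd (T : E →ₗ.[ℝ] E) (S : E →L[ℝ] E) (k : ℝ) : Prop where
  right_inv : ∀ y, ∃ h : S y ∈ T.domain, S y + k • T ⟨S y, h⟩ = y
  left_inv : ∀ x : T.domain, S ((x : E) + k • T x) = x

theorem IsInverseOneAdd.neg_inv_mem_resolventSetPMap {T : E →ₗ.[ℝ] E} {S : E →L[ℝ] E} {k : ℝ}
    (h : IsInverseOneAdd T S k) (hk : k ≠ 0) : -k⁻¹ ∈ resolventSetPMap T := by
  refine ⟨k • S, fun y => ?_, fun x => ?_⟩
  · obtain ⟨hy, h1⟩ := h.right_inv y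
    have hmem : (k • S) y ∈ T.domain := T.domain.smul_mem k hy
    refine ⟨hmem, ?_⟩
    have h2 : T ⟨(k • S) y, hmem⟩ = k • T ⟨S y, hy⟩ := T.toFun.map_smul k ⟨S y, hy⟩
    rw [h2]
    change k • T ⟨S y, hy⟩ - (-k⁻¹) • k • S y = y
    conv_rhs => rw [← h1]
    rw [smul_smul]
    have : -k⁻¹ * k = -1 := by field_simp
    rw [this]; module
  · have h1 := h.left_inv x
    change k • S (T x - (-k⁻¹) • (x : E)) = x
    rw [← map_smul]
    convert h1 using 2
    rw [smul_sub, smul_smul]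
    have : k * -k⁻¹ = -1 := by field_simp
    rw [this]; module

/-- The relation `htl` says `t = 1 / (1 + k l)`. Then `(S - t) y = -t k (T - l) (S y)`, and `T - l`
has a bounded inverse, so `S y`, and with it `y`, is controlled by `(S - t) y`. -/
theorem IsInverseOneAdd.boundedBelow_sub {T : E →ₗ.[ℝ] E} {S : E →L[ℝ] E} {k : ℝ}
    (h : IsInverseOneAdd T S k) (hk : k ≠ 0) {l t : ℝ} (hl : l ∈ resolventSetPMap T)
    (ht : t ≠ 0) (htl : t * k * l = 1 - t) :
    BoundedBelow (S - t • ContinuousLinearMap.id ℝ E) := by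
  obtain ⟨K, -, hK⟩ := hl
  refine ⟨(((‖K‖ / |t * k|) + 1) / |t|)⁻¹, by have := abs_pos.2 ht; positivity, fun y => ?_⟩
  rw [inv_mul_le_iff₀ (by have := abs_pos.2 ht; positivity)]
  obtain ⟨hy, h1⟩ := h.right_inv y
  set z := (S - t • ContinuousLinearMap.id ℝ E) y with hz
  have hz' : z = S y - t • y := by simp [hz]
  have h2 : (t * k) • (T ⟨S y, hy⟩ - l • S y) = -z := by
    have h3 : t • y = t • S y + (t * k) • T ⟨S y, hy⟩ := by
      conv_lhs => rw [← h1]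
      module
    rw [hz', h3, smul_sub, smul_smul, htl]
    module
  have h3 : (t * k) • S y = - K z := by
    have := hK ⟨S y, hy⟩
    rw [← map_neg, ← h2, map_smul, this]
  have htk : 0 < |t * k| := abs_pos.2 (mul_ne_zero ht hk)
  have h4 : |t * k| * ‖S y‖ ≤ ‖K‖ * ‖z‖ := by
    rw [← Real.norm_eq_abs, ← norm_smul, h3, norm_neg]
    exact K.le_opNorm _
  have h5 : |t| * ‖y‖ ≤ ‖S y‖ + ‖z‖ := by
    rw [← Real.norm_eq_abs, ← norm_smul, show t • y = S y - z by rw [hz']; module]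
    exact norm_sub_le _ _
  have h6 : ‖S y‖ ≤ ‖K‖ / |t * k| * ‖z‖ := by
    rw [div_mul_eq_mul_div, le_div_iff₀ htk]; linarith
  rw [div_mul_eq_mul_div, le_div_iff₀ (abs_pos.2 ht)]
  nlinarith

/-- At a point of the discrete spectrum there is no singular Weyl sequence. -/
theorem IsInverseOneAdd.exists_le_norm_of_mem_discreteSpectrumPMap [CompleteSpace E]
    {T : E →ₗ.[ℝ] E} {S : E →L[ℝ] E} {k : ℝ}
    (h : IsInverseOneAdd T S k) (hk : 0 < k)
    (hS : ∀ x y, inner ℝ (S x) y = inner ℝ x (S y)) {l μ : ℝ}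
    (hl : l ∈ discreteSpectrumPMap T) (hμ : 0 < μ) (hμl : μ * k * l = 1 - μ) :
    ∃ W : Submodule ℝ E, FiniteDimensional ℝ W ∧ ∃ η : ℝ, 0 < η ∧ ∀ y ∈ Wᗮ,
      η * ‖y‖ ≤ ‖S y - μ • y‖ := by
  obtain ⟨-, ⟨ε, hε, hiso⟩, -, hfin⟩ := hl
  set A : E →L[ℝ] E := S - μ • ContinuousLinearMap.id ℝ E with hA
  have hAap : ∀ y, A y = S y - μ • y := fun y => by simp [hA]
  -- Isolation of `l` passes to `μ` because `t ↦ (t⁻¹ - 1) / k`, which sends `μ` to `l`, is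
  -- continuous at `μ`.
  have hlim : Tendsto (fun t : ℝ => ((μ + t)⁻¹ - 1) / k) (𝓝 0) (𝓝 (((μ + 0)⁻¹ - 1) / k)) := by
    have : Tendsto (fun t : ℝ => μ + t) (𝓝 0) (𝓝 (μ + 0)) := tendsto_const_nhds.add tendsto_id
    exact ((this.inv₀ (by simpa using hμ.ne')).sub_const 1).div_const k
  have hl' : ((μ + 0)⁻¹ - 1) / k = l := by
    rw [add_zero]; field_simp; linarith
  rw [hl'] at hlim
  obtain ⟨δ, hδ, hδε⟩ := Metric.tendsto_nhds_nhds.1 hlim ε hε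
  have hgap : ∀ t, t ≠ 0 → |t| < min δ μ → BoundedBelow (A - t • ContinuousLinearMap.id ℝ E) := by
    intro t ht htδ
    have h1 : |t| < δ := htδ.trans_le (min_le_left _ _)
    have h2 : 0 < μ + t := by linarith [(abs_lt.1 (htδ.trans_le (min_le_right _ _))).1]
    set l' := ((μ + t)⁻¹ - 1) / k with hl'def
    have h3 : |l' - l| < ε := by
      have := @hδε t (by simpa using h1)
      rwa [Real.dist_eq] at this
    have h4 : (μ + t) * k * l' = 1 - (μ + t) := by rw [hl'def]; field_simp
    have h5 : l' ∈ resolventSetPMap T := by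
      by_contra hn
      have h6 := hiso l' hn h3
      rw [h6] at h4
      have h7 : t * (k * l + 1) = 0 := by linarith
      have h8 : μ * (k * l + 1) = 1 := by linarith
      rcases mul_eq_zero.1 h7 with h9 | h9
      · exact ht h9
      · rw [h9] at h8; simp at h8
    convert h.boundedBelow_sub hk.ne' h5 h2.ne' h4 using 1
    rw [hA]; module
  refine ⟨LinearMap.ker (A : E →ₗ[ℝ] E), ?_, min δ μ, by positivity, fun y hy => ?_⟩
  · have hmem : ∀ y ∈ LinearMap.ker (A : E →ₗ[ℝ] E), ∃ hy : y ∈ T.domain, T ⟨y, hy⟩ = l • y := by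
      intro y hy
      have h1 : S y = μ • y := by
        have : A y = 0 := hy
        rwa [hAap, sub_eq_zero] at this
      obtain ⟨h2, h3⟩ := h.right_inv y
      have h4 : y ∈ T.domain := by
        have := T.domain.smul_mem μ⁻¹ h2
        rwa [h1, smul_smul, inv_mul_cancel₀ hμ.ne', one_smul] at this
      refine ⟨h4, ?_⟩
      have h5 : T ⟨S y, h2⟩ = μ • T ⟨y, h4⟩ := by
        have h6 : (⟨S y, h2⟩ : T.domain) = μ • ⟨y, h4⟩ := Subtype.ext h1
        rw [h6]; exact T.toFun.map_smul _ _
      rw [h5, h1] at h3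
      have h7 : (μ * k) • T ⟨y, h4⟩ = (μ * k) • l • y := by
        rw [smul_smul, hμl, sub_smul, one_smul]
        conv_rhs => arg 1; rw [← h3]
        module
      exact smul_right_injective E (mul_pos hμ hk).ne' h7
    let f : LinearMap.ker (A : E →ₗ[ℝ] E) →ₗ[ℝ] eigenspacePMap T l :=
      { toFun := fun y => ⟨⟨y, (hmem y y.2).1⟩, by
          rw [eigenspacePMap, LinearMap.mem_ker, LinearMap.sub_apply, sub_eq_zero]
          exact (hmem y y.2).2⟩
        map_add' := fun _ _ => rfl
        map_smul' := fun _ _ => rfl }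
    refine FiniteDimensional.of_injective f fun x y hxy => ?_
    have := congrArg (fun z : eigenspacePMap T l => ((z : T.domain) : E)) hxy
    exact Subtype.ext this
  · rw [← hAap]
    exact le_norm_of_mem_ker_orthogonal A (fun x y => by
      simp only [hAap, inner_sub_left, inner_sub_right, real_inner_smul_left,
        real_inner_smul_right, hS]) (by positivity) hgap hy

/-- Each `μ > 0` corresponds to `l = (μ⁻¹ - 1) / k`, a resolvent point or a discrete eigenvalue; in
both cases `S - μ` is bounded below on a subspace of finite codimension. The conclusion is the
compactness of `S` in form language. -/
theorem IsInverseOneAdd.exists_inner_le_of_essentialSpectrumPMap_eq_empty [CompleteSpace E]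
    {T : E →ₗ.[ℝ] E} {S : E →L[ℝ] E} {k : ℝ}
    (h : IsInverseOneAdd T S k) (hk : 0 < k)
    (hS : ∀ x y, inner ℝ (S x) y = inner ℝ x (S y)) (hpos : ∀ x, 0 ≤ inner ℝ (S x) x)
    (hess : essentialSpectrumPMap T = ∅) {ε : ℝ} (hε : 0 < ε) :
    ∃ V : Submodule ℝ E, FiniteDimensional ℝ V ∧ ∀ y ∈ Vᗮ, inner ℝ (S y) y ≤ ε * ‖y‖ ^ 2 := by
  refine exists_finiteDimensional_inner_le S hS hpos (fun μ hμ => ?_) hε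
  have hl : μ * k * ((μ⁻¹ - 1) / k) = 1 - μ := by field_simp
  by_cases hr : (μ⁻¹ - 1) / k ∈ resolventSetPMap T
  · obtain ⟨c, hc, hb⟩ := h.boundedBelow_sub hk.ne' hr hμ.ne' hl
    exact ⟨⊥, inferInstance, c, hc, fun y _ => by simpa using hb y⟩
  · refine h.exists_le_norm_of_mem_discreteSpectrumPMap hk hS ?_ hμ hl
    by_contra hd
    exact (Set.eq_empty_iff_forall_notMem.1 hess) _ ⟨hr, hd⟩

variable {H : Type*} [NormedAddCommGroup H] [InnerProductSpace ℝ H] [CompleteSpace E]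
  [CompleteSpace H]

open ContinuousLinearMap in
theorem inner_comp_adjoint_self (j : H →L[ℝ] E) (y : E) :
    inner ℝ ((j ∘L adjoint j) y) y = ‖adjoint j y‖ ^ 2 := by
  rw [comp_apply, ← adjoint_inner_right, real_inner_self_eq_norm_sq]

open ContinuousLinearMap in
theorem inner_comp_adjoint_symm (j : H →L[ℝ] E) (x y : E) :
    inner ℝ ((j ∘L adjoint j) x) y = inner ℝ x ((j ∘L adjoint j) y) := by
  rw [comp_apply, comp_apply, ← adjoint_inner_right, adjoint_inner_left]

open ContinuousLinearMap in
theorem norm_apply_sq_le_of_adjoint (j : H →L[ℝ] E) (w : H) :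
    ‖j w‖ ^ 2 ≤ ‖w‖ * ‖adjoint j (j w)‖ := by
  rw [← real_inner_self_eq_norm_sq, ← adjoint_inner_right]
  exact real_inner_le_norm _ _

/-- If zero is in the resolvent set, the form satisfies a Poincaré inequality. -/
theorem IsInverseOneAdd.exists_mul_le_of_zero_mem_resolventSetPMap
    {T : E →ₗ.[ℝ] E} {j : H →L[ℝ] E} {k : ℝ}
    (h : IsInverseOneAdd T (j ∘L ContinuousLinearMap.adjoint j) k) (hk : 0 < k)
    (hj : ‖j‖ ≤ 1) (h0 : (0 : ℝ) ∈ resolventSetPMap T) :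
    ∃ c > 0, ∀ w, c * ‖j w‖ ^ 2 ≤ ‖w‖ ^ 2 - ‖j w‖ ^ 2 := by
  set S := j ∘L ContinuousLinearMap.adjoint j with hS
  -- The point `l = 0` corresponds to `t = 1`. As `1 - S` is nonnegative, a lower bound `d` for its
  -- form gives `‖j* y‖² ≤ (1 - d)‖y‖²`, and `j` inherits the bound from its adjoint.
  have hb := h.boundedBelow_sub hk.ne' h0 one_ne_zero (by simp)
  obtain ⟨c, hc, hcb⟩ := hb
  set A : E →L[ℝ] E := ContinuousLinearMap.id ℝ E - S with hA
  have hAap : ∀ y, A y = y - S y := fun y => by simp [hA]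
  have hAin : ∀ y, inner ℝ (A y) y = ‖y‖ ^ 2 - ‖ContinuousLinearMap.adjoint j y‖ ^ 2 := fun y => by
    rw [hAap, inner_sub_left, hS, inner_comp_adjoint_self, real_inner_self_eq_norm_sq]
  have hadj : ∀ y, ‖ContinuousLinearMap.adjoint j y‖ ≤ ‖y‖ := fun y => by
    refine (ContinuousLinearMap.le_opNorm _ _).trans ?_
    rw [LinearIsometryEquiv.norm_map]
    exact mul_le_of_le_one_left (norm_nonneg _) hj
  obtain ⟨d, hd, hdA⟩ := exists_pos_le_inner_of_boundedBelow A
    (fun x y => by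
      simp only [hAap, inner_sub_left, inner_sub_right]
      rw [hS, inner_comp_adjoint_symm])
    (fun y => by
      rw [hAin]
      have : ‖ContinuousLinearMap.adjoint j y‖ ^ 2 ≤ ‖y‖ ^ 2 := by gcongr; exact hadj y
      linarith)
    ⟨c, hc, fun y => by
      convert hcb y using 1
      rw [← norm_neg]
      congr 1
      simp [hAap]⟩
  refine ⟨d, hd, fun w => ?_⟩
  have h1 := norm_apply_sq_le_of_adjoint j w
  have h2 := hdA (j w)
  rw [hAin] at h2
  set a := ‖ContinuousLinearMap.adjoint j (j w)‖
  have ha : 0 ≤ a := norm_nonneg _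
  rcases (norm_nonneg (j w)).eq_or_lt with h3 | h3
  · rw [← h3]; nlinarith [norm_nonneg w]
  · have h4 : (‖j w‖ ^ 2) * ‖j w‖ ^ 2 ≤ ‖w‖ ^ 2 * ((1 - d) * ‖j w‖ ^ 2) := by
      calc _ ≤ (‖w‖ * a) * (‖w‖ * a) := mul_le_mul h1 h1 (by positivity) (by positivity)
        _ = ‖w‖ ^ 2 * a ^ 2 := by ring
        _ ≤ _ := by gcongr; linarith
    have h5 : ‖j w‖ ^ 2 ≤ (1 - d) * ‖w‖ ^ 2 := by
      refine le_of_mul_le_mul_right (h4.trans_eq (by ring)) (by positivity : 0 < ‖j w‖ ^ 2)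
    have h6 : ‖j w‖ ^ 2 ≤ ‖w‖ ^ 2 := by
      gcongr
      exact (j.le_opNorm w).trans (mul_le_of_le_one_left (norm_nonneg _) hj)
    have h7 : d * ‖j w‖ ^ 2 ≤ d * ‖w‖ ^ 2 := by gcongr
    linarith

end UnboundedOperators

noncomputable section

/-! ### Functions vanishing on a large finite set. -/

section Tails

/-- A function vanishing on `F` sees only the tail of `v`, which has small norm. -/
theorem exists_finset_abs_inner_le {ι : Type*} (v : lp (fun _ : ι => ℝ) 2) {η : ℝ} (hη : 0 < η) :
    ∃ F : Finset ι, ∀ y : lp (fun _ : ι => ℝ) 2, (∀ x ∈ F, y x = 0) →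
      |inner ℝ v y| ≤ η * ‖y‖ := by
  classical
  have h := lp.hasSum_single (p := 2) (by norm_num) v
  obtain ⟨F, hF⟩ := (h.eventually (Metric.ball_mem_nhds v hη)).exists
  refine ⟨F, fun y hy => ?_⟩
  set s := ∑ i ∈ F, lp.single 2 i (v i) with hs
  have h0 : inner ℝ s y = 0 := by
    rw [hs, sum_inner]
    refine Finset.sum_eq_zero fun x hx => ?_
    rw [lp.inner_single_left, hy x hx]; simp
  have h1 : inner ℝ v y = inner ℝ (v - s) y := by rw [inner_sub_left, h0, sub_zero]
  rw [h1]
  refine (abs_real_inner_le_norm _ _).trans ?_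
  gcongr
  rw [← dist_eq_norm, dist_comm]
  exact le_of_lt hF

theorem exists_finset_norm_starProjection_le {ι : Type*}
    (V : Submodule ℝ (lp (fun _ : ι => ℝ) 2)) [FiniteDimensional ℝ V] {κ : ℝ} (hκ : 0 < κ) :
    ∃ F : Finset ι, ∀ y : lp (fun _ : ι => ℝ) 2, (∀ x ∈ F, y x = 0) →
      ‖V.starProjection y‖ ≤ κ * ‖y‖ := by
  classical
  set b := stdOrthonormalBasis ℝ V with hb
  set n := Module.finrank ℝ V with hn
  choose F hF using fun i =>
    exists_finset_abs_inner_le (b i : lp (fun _ : ι => ℝ) 2) (η := κ / (n + 1)) (by positivity)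
  refine ⟨Finset.univ.biUnion F, fun y hw => ?_⟩
  have h1 : V.starProjection y =
      ∑ i, inner ℝ (b i : lp (fun _ : ι => ℝ) 2) y • (b i : lp (fun _ : ι => ℝ) 2) := by
    rw [Submodule.starProjection_apply, b.orthogonalProjectionOnto_apply_eq_sum y,
      Submodule.coe_sum]
    rfl
  rw [h1]
  refine (norm_sum_le _ _).trans ?_
  have h2 : ∀ i ∈ Finset.univ, ‖inner ℝ (b i : lp (fun _ : ι => ℝ) 2) y •
      (b i : lp (fun _ : ι => ℝ) 2)‖ ≤ κ / (n + 1) * ‖y‖ := by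
    intro i _
    have : ‖(b i : lp (fun _ : ι => ℝ) 2)‖ = 1 := b.orthonormal.1 i
    rw [norm_smul, this, mul_one]
    exact hF i y fun x hx => hw x (Finset.mem_biUnion.2 ⟨i, Finset.mem_univ _, hx⟩)
  refine (Finset.sum_le_card_nsmul _ _ _ h2).trans ?_
  rw [Finset.card_univ, Fintype.card_fin, nsmul_eq_mul, ← mul_assoc]
  gcongr
  rw [mul_div_assoc', div_le_iff₀ (by positivity)]
  nlinarith

/-- Split `j w` along `V`: the adjoint is small on the complement by `hV`, and the component in `V`
is itself small. Then `‖j w‖² ≤ ‖w‖ ‖j* (j w)‖` carries the bound back to `j`. -/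
theorem norm_apply_le_of_norm_starProjection_le {E H : Type*} [NormedAddCommGroup E]
    [InnerProductSpace ℝ E] [CompleteSpace E] [NormedAddCommGroup H] [InnerProductSpace ℝ H]
    [CompleteSpace H] (j : H →L[ℝ] E) (hj : ‖j‖ ≤ 1) (V : Submodule ℝ E) [FiniteDimensional ℝ V]
    {κ : ℝ} (hκ : 0 < κ)
    (hV : ∀ y ∈ Vᗮ, ‖ContinuousLinearMap.adjoint j y‖ ^ 2 ≤ κ ^ 2 * ‖y‖ ^ 2) (w : H)
    (hw : ‖V.starProjection (j w)‖ ≤ κ * ‖j w‖) : ‖j w‖ ≤ 2 * κ * ‖w‖ := by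
  have hadj : ∀ y, ‖ContinuousLinearMap.adjoint j y‖ ≤ ‖y‖ := fun y => by
    refine (ContinuousLinearMap.le_opNorm _ _).trans ?_
    rw [LinearIsometryEquiv.norm_map]
    exact mul_le_of_le_one_left (norm_nonneg _) hj
  set y := j w with hy
  set p := V.starProjection y with hp
  have hq : y - p ∈ Vᗮ := V.sub_starProjection_mem_orthogonal y
  have hqn : ‖y - p‖ ≤ ‖y‖ := by
    refine le_of_sq_le_sq ?_ (norm_nonneg _)
    have h1 : inner ℝ p (y - p) = 0 :=
      (Submodule.mem_orthogonal _ _).1 hq p (V.starProjection_apply_mem y)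
    have h2 : y = p + (y - p) := by abel
    have h3 : ‖y‖ ^ 2 = ‖p‖ ^ 2 + ‖y - p‖ ^ 2 := by
      conv_lhs => rw [h2]
      rw [norm_add_sq_real, h1]; ring
    nlinarith [sq_nonneg ‖p‖]
  have h1 : ‖ContinuousLinearMap.adjoint j (y - p)‖ ≤ κ * ‖y‖ := by
    have := hV _ hq
    rw [← mul_pow] at this
    exact (le_of_sq_le_sq this (by positivity)).trans (by gcongr)
  have h2 : ‖ContinuousLinearMap.adjoint j y‖ ≤ 2 * κ * ‖y‖ := by
    have h3 : ContinuousLinearMap.adjoint j y =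
        ContinuousLinearMap.adjoint j (y - p) + ContinuousLinearMap.adjoint j p := by
      rw [← map_add, sub_add_cancel]
    rw [h3]
    refine (norm_add_le _ _).trans ?_
    linarith [hadj p]
  have h3 := norm_apply_sq_le_of_adjoint j w
  rw [← hy] at h3
  rcases (norm_nonneg y).eq_or_lt with h0 | h0
  · rw [← h0]; positivity
  have : ‖y‖ * ‖y‖ ≤ (2 * κ * ‖w‖) * ‖y‖ := by
    nlinarith [mul_le_mul_of_nonneg_left h2 (norm_nonneg w)]
  exact le_of_mul_le_mul_right this h0

end Tails

/-! ### The form domain, the resolvent and the maximum principle. -/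

section FormSpace

open scoped Classical in
/-- The form domain of the graph Laplacian, embedded in `ℓ²(X) × ℓ²(X × X)` by
`u ↦ (u, c ∇u)`. -/
def formSpace {X : Type*} (G : SimpleGraph X) (c : ℝ) :
    Submodule ℝ (WithLp 2 (lp (fun _ : X => ℝ) 2 × lp (fun _ : X × X => ℝ) 2)) where
  carrier := {w | ∀ x y, w.snd (x, y) = if G.Adj x y then c * (w.fst x - w.fst y) else 0}
  zero_mem' := fun x y => by simp
  add_mem' := fun {v w} hv hw x y => by
    simp only [WithLp.add_fst, WithLp.add_snd, lp.coeFn_add, Pi.add_apply, hv x y, hw x y]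
    split_ifs <;> ring
  smul_mem' := fun a w hw x y => by
    simp only [WithLp.smul_fst, WithLp.smul_snd, lp.coeFn_smul, Pi.smul_apply, hw x y,
      smul_eq_mul]
    split_ifs <;> ring

variable {X : Type*} (G : SimpleGraph X)

open scoped Classical in
theorem formSpace_snd_apply {c : ℝ} (w : formSpace G c) (x y : X) :
    w.1.snd (x, y) = if G.Adj x y then c * (w.1.fst x - w.1.fst y) else 0 := w.2 x y

theorem continuous_lp_apply {ι : Type*} (i : ι) :
    Continuous fun f : lp (fun _ : ι => ℝ) 2 => f i :=
  (lp.evalCLM ℝ (fun _ : ι => ℝ) 2 i).continuous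

theorem isClosed_formSpace (c : ℝ) :
    IsClosed (formSpace G c : Set (WithLp 2 (lp (fun _ : X => ℝ) 2 × lp (fun _ : X × X => ℝ) 2))) := by
  classical
  have : (formSpace G c : Set (WithLp 2 (lp (fun _ : X => ℝ) 2 × lp (fun _ : X × X => ℝ) 2))) =
      ⋂ x, ⋂ y, {w | w.snd (x, y) = if G.Adj x y then c * (w.fst x - w.fst y) else 0} := by
    ext w
    simp only [Set.mem_iInter]
    exact Iff.rfl
  rw [this]
  refine isClosed_iInter fun x => isClosed_iInter fun y => ?_
  have h1 : ∀ z, Continuous fun w : WithLp 2 (lp (fun _ : X => ℝ) 2 × lp (fun _ : X × X => ℝ) 2) =>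
      w.fst z := fun z =>
    (continuous_lp_apply z).comp (WithLp.fstL 2 ℝ _ _).continuous
  have h2 : ∀ z, Continuous fun w : WithLp 2 (lp (fun _ : X => ℝ) 2 × lp (fun _ : X × X => ℝ) 2) =>
      w.snd z := fun z =>
    (continuous_lp_apply z).comp (WithLp.sndL 2 ℝ _ _).continuous
  refine isClosed_eq (h2 _) ?_
  split_ifs
  · exact ((h1 x).sub (h1 y)).const_mul c
  · exact continuous_const

instance (c : ℝ) : CompleteSpace (formSpace G c) :=
  (isClosed_formSpace G c).completeSpace_coe

/-- The inclusion of the form domain into `ℓ²(X)`. -/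
def formInclusion (c : ℝ) : formSpace G c →L[ℝ] lp (fun _ : X => ℝ) 2 :=
  (WithLp.fstL 2 ℝ _ _) ∘L (formSpace G c).subtypeL

theorem formInclusion_apply {c : ℝ} (w : formSpace G c) : formInclusion G c w = w.1.fst := rfl

theorem formSpace_norm_sq {c : ℝ} (w : formSpace G c) :
    ‖w‖ ^ 2 = ‖formInclusion G c w‖ ^ 2 + ‖w.1.snd‖ ^ 2 :=
  WithLp.prod_norm_sq_eq_of_L2 w.1

theorem norm_formInclusion_le (c : ℝ) : ‖formInclusion G c‖ ≤ 1 := by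
  refine ContinuousLinearMap.opNorm_le_bound _ zero_le_one fun w => ?_
  rw [one_mul]
  refine le_of_sq_le_sq ?_ (norm_nonneg _)
  rw [formSpace_norm_sq]
  linarith [sq_nonneg ‖w.1.snd‖]

variable [G.LocallyFinite]

open scoped Classical in
/-- The unit mass at a vertex as an element of the form domain. -/
def formSingle (c : ℝ) (x : X) : formSpace G c :=
  ⟨WithLp.toLp 2 (lp.single 2 x 1, ∑ y ∈ G.neighborFinset x,
      (lp.single 2 (x, y) c - lp.single 2 (y, x) c)), fun a b => by
    simp only [WithLp.toLp_snd, WithLp.toLp_fst, lp.coeFn_sum, Finset.sum_apply, lp.coeFn_sub,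
      Pi.sub_apply, lp.single_apply, Pi.single_apply, Prod.mk.injEq, Finset.sum_sub_distrib]
    have h1 : (∑ y ∈ G.neighborFinset x, if a = x ∧ b = y then c else 0) =
        if G.Adj a b ∧ a = x then c else 0 := by
      by_cases ha : a = x
      · subst ha
        simp
      · simp [ha]
    have h2 : (∑ y ∈ G.neighborFinset x, if a = y ∧ b = x then c else 0) =
        if G.Adj a b ∧ b = x then c else 0 := by
      by_cases hb : b = x
      · subst hb
        simp [G.adj_comm]
      · simp [hb]
    rw [h1, h2]
    by_cases h : G.Adj a b
    · simp only [h, true_and, if_true]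
      split_ifs <;> ring
    · simp [h]⟩

open scoped Classical in
theorem formSingle_fst (c : ℝ) (x : X) : (formSingle G c x).1.fst = lp.single 2 x 1 := rfl

/-- Each edge at `x` occurs in both orientations, whence the factor 2. -/
theorem inner_formSingle {c : ℝ} (x : X) (w : formSpace G c) :
    inner ℝ (formSingle G c x) w =
      w.1.fst x + 2 * c ^ 2 * formalLaplacian G (w.1.fst : X → ℝ) x := by
  classical
  rw [Submodule.coe_inner, WithLp.prod_inner_apply]
  change inner ℝ (lp.single 2 x (1 : ℝ) : lp (fun _ : X => ℝ) 2) w.1.fst +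
    inner ℝ (∑ y ∈ G.neighborFinset x,
      (lp.single 2 (x, y) c - lp.single 2 (y, x) c) : lp (fun _ : X × X => ℝ) 2) w.1.snd = _
  rw [sum_inner]
  simp only [inner_sub_left]
  have h1 : inner ℝ (lp.single 2 x (1 : ℝ)) w.1.fst = w.1.fst x := by
    rw [lp.inner_single_left]; simp
  rw [h1]
  congr 1
  change _ = 2 * c ^ 2 * ∑ y ∈ G.neighborFinset x, (w.1.fst x - w.1.fst y)
  rw [Finset.mul_sum]
  refine Finset.sum_congr rfl fun y hy => ?_
  have hxy : G.Adj x y := by simpa using hy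
  rw [lp.inner_single_left, lp.inner_single_left, formSpace_snd_apply, formSpace_snd_apply,
    if_pos hxy, if_pos hxy.symm]
  simp
  ring

/-- The bounded inverse of `1 + 2c²Δ`. -/
def laplacianResolvent (c : ℝ) : lp (fun _ : X => ℝ) 2 →L[ℝ] lp (fun _ : X => ℝ) 2 :=
  formInclusion G c ∘L ContinuousLinearMap.adjoint (formInclusion G c)

/-- The weak equation defining the adjoint, tested against the unit mass at `x`. -/
theorem laplacianResolvent_apply_add (c : ℝ) (y : lp (fun _ : X => ℝ) 2) (x : X) :
    laplacianResolvent G c y x +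
      2 * c ^ 2 * formalLaplacian G (laplacianResolvent G c y : X → ℝ) x = y x := by
  classical
  have h := inner_formSingle G x (ContinuousLinearMap.adjoint (formInclusion G c) y)
  rw [ContinuousLinearMap.adjoint_inner_right] at h
  refine h.symm.trans ?_
  rw [formInclusion_apply, formSingle_fst, lp.inner_single_left]
  simp

/-- Strong maximum principle in `ℓ²`. -/
theorem le_zero_of_formalLaplacian_le [Infinite X] (hG : G.Connected) (u : lp (fun _ : X => ℝ) 2)
    (hu : ∀ x, 0 < u x → formalLaplacian G (u : X → ℝ) x ≤ 0) (x : X) : u x ≤ 0 := by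
  by_contra! hx
  have hcof : Tendsto (fun y => ‖u y‖ ^ (2 : ℝ)) cofinite (𝓝 0) := by
    have := (lp.memℓp u).summable (by norm_num)
    simpa using this.tendsto_cofinite_zero
  -- Decay of `u` makes this superlevel set finite, so a positive maximum is attained. It propagates
  -- along edges to all of `X`, which would then be finite.
  have hfin : {y | u x ≤ u y}.Finite := by
    have h1 : ∀ᶠ y in cofinite, ‖u y‖ ^ (2 : ℝ) < (u x) ^ 2 :=
      hcof.eventually (gt_mem_nhds (by positivity))
    refine Set.Finite.subset h1 fun y hy => ?_
    simp only [Set.mem_compl_iff, Set.mem_ofPred_eq, not_lt, Real.norm_eq_abs] at hy ⊢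
    norm_cast
    rw [sq_abs]
    have : u x ≤ u y := hy
    gcongr
  obtain ⟨z, hz, hmax⟩ := Set.exists_max_image _ (fun y => u y) hfin ⟨x, le_refl (u x)⟩
  have hz0 : 0 < u z := lt_of_lt_of_le hx hz
  have hle : ∀ y, u y ≤ u z := fun y => by
    by_cases h : u x ≤ u y
    · exact hmax y h
    · exact (not_le.1 h).le.trans hz
  have hstep : ∀ a b, G.Adj a b → u a = u z → u b = u z := by
    intro a b hab ha
    have h1 := hu a (by rw [ha]; exact hz0)
    have h2 : ∀ y ∈ G.neighborFinset a, 0 ≤ u a - u y := fun y _ => by rw [ha]; linarith [hle y]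
    have h3 : ∑ y ∈ G.neighborFinset a, (u a - u y) = 0 :=
      le_antisymm h1 (Finset.sum_nonneg h2)
    have := (Finset.sum_eq_zero_iff_of_nonneg h2).1 h3 b (by simpa using hab)
    linarith
  have hall : ∀ y, u y = u z := by
    intro y
    obtain ⟨p⟩ := hG.preconnected z y
    have : ∀ a b : X, G.Walk a b → u a = u z → u b = u z := by
      intro a b p
      induction p with
      | nil => exact id
      | cons h p ih => exact fun ha => ih (hstep _ _ h ha)
    exact this z y p rfl
  refine Set.infinite_univ (hfin.subset fun y _ => ?_)
  change u x ≤ u y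
  rw [hall y]; exact hz

theorem eq_zero_of_formalLaplacian_eq [Infinite X] (hG : G.Connected) (u : lp (fun _ : X => ℝ) 2)
    {a : ℝ} (ha : 0 ≤ a) (hu : ∀ x, formalLaplacian G (u : X → ℝ) x = -(a * u x)) : u = 0 := by
  ext x
  refine le_antisymm ?_ ?_
  · refine le_zero_of_formalLaplacian_le G hG u (fun y hy => ?_) x
    rw [hu y]; nlinarith
  · have := le_zero_of_formalLaplacian_le G hG (-u) (fun y hy => ?_) x
    · rw [lp.coeFn_neg, Pi.neg_apply] at this
      simpa using this
    · rw [lp.coeFn_neg, Pi.neg_apply] at hy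
      rw [lp.coeFn_neg, map_neg, Pi.neg_apply, hu y]; nlinarith

theorem isInverseOneAdd_graphLaplacian [Infinite X] (hG : G.Connected) {c : ℝ} (hc : c ≠ 0) :
    IsInverseOneAdd (graphLaplacian G) (laplacianResolvent G c) (2 * c ^ 2) := by
  have hr : ∀ y, ∃ h : laplacianResolvent G c y ∈ (graphLaplacian G).domain,
      laplacianResolvent G c y +
        (2 * c ^ 2) • (graphLaplacian G) ⟨laplacianResolvent G c y, h⟩ = y := by
    intro y
    have h := laplacianResolvent_apply_add G c y
    have hmem : laplacianResolvent G c y ∈ (graphLaplacian G).domain := by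
      change Memℓp (formalLaplacian G (laplacianResolvent G c y : X → ℝ)) 2
      have : formalLaplacian G (laplacianResolvent G c y : X → ℝ) =
          (((2 * c ^ 2)⁻¹ • (y - laplacianResolvent G c y) : lp (fun _ : X => ℝ) 2) : X → ℝ) := by
        funext x
        rw [lp.coeFn_smul, Pi.smul_apply, lp.coeFn_sub, Pi.sub_apply, ← h x, smul_eq_mul]
        field_simp
        ring
      rw [this]
      exact lp.memℓp _
    refine ⟨hmem, ?_⟩
    ext x
    exact h x
  refine ⟨hr, fun x => ?_⟩
  obtain ⟨h1, h2⟩ := hr ((x : lp (fun _ : X => ℝ) 2) + (2 * c ^ 2) • (graphLaplacian G) x)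
  set z := laplacianResolvent G c ((x : lp (fun _ : X => ℝ) 2) + (2 * c ^ 2) • (graphLaplacian G) x)
  rw [← sub_eq_zero]
  -- Injectivity of `1 + 2c²Δ` on the maximal domain comes from the maximum principle, applied to
  -- the difference of two preimages.
  refine eq_zero_of_formalLaplacian_eq G hG (z - x) (a := (2 * c ^ 2)⁻¹) (by positivity) fun a => ?_
  have h3 := congrArg (fun f : lp (fun _ : X => ℝ) 2 => f a) h2
  change z a + (2 * c ^ 2) * formalLaplacian G (z : X → ℝ) a =
    x.1 a + (2 * c ^ 2) * formalLaplacian G (x.1 : X → ℝ) a at h3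
  rw [lp.coeFn_sub, map_sub, Pi.sub_apply, Pi.sub_apply]
  field_simp
  linarith

theorem mem_resolventSetPMap_of_neg [Infinite X] (hG : G.Connected) {l : ℝ} (hl : l < 0) :
    l ∈ resolventSetPMap (graphLaplacian G) := by
  set c := Real.sqrt ((-(2 * l))⁻¹)
  have hp : 0 < (-(2 * l))⁻¹ := inv_pos.2 (by linarith)
  have hc : 0 < c := Real.sqrt_pos.2 hp
  have hc2 : c ^ 2 = (-(2 * l))⁻¹ := Real.sq_sqrt hp.le
  have := (isInverseOneAdd_graphLaplacian G hG hc.ne').neg_inv_mem_resolventSetPMap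
    (by positivity)
  rw [hc2] at this
  convert this using 1
  have := hl.ne
  field_simp

theorem zero_notMem_discreteSpectrumPMap [Infinite X] (hG : G.Connected) :
    (0 : ℝ) ∉ discreteSpectrumPMap (graphLaplacian G) := by
  rintro ⟨-, -, hne, -⟩
  refine hne ((Submodule.eq_bot_iff _).2 fun x hx => ?_)
  rw [eigenspacePMap, LinearMap.mem_ker, LinearMap.sub_apply, zero_smul, LinearMap.zero_apply,
    sub_zero] at hx
  refine Subtype.ext (eq_zero_of_formalLaplacian_eq G hG x.1 le_rfl fun a => ?_)
  have := congrArg (fun f : lp (fun _ : X => ℝ) 2 => f a) hx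
  rw [zero_mul, neg_zero]
  exact this

/-- If the spectrum of the Laplacian is purely discrete, the Rayleigh quotients outside of finite
sets tend to infinity. -/
theorem exists_finset_mul_norm_sq_le [Infinite X] (hG : G.Connected)
    (hess : essentialSpectrumPMap (graphLaplacian G) = ∅) (K : ℝ) :
    ∃ F : Finset X, ∀ w : formSpace G 1, (∀ x ∈ F, w.1.fst x = 0) →
      K * ‖w.1.fst‖ ^ 2 ≤ ‖w‖ ^ 2 := by
  set κ : ℝ := 1 / (2 * (|K| + 1)) with hκ
  have hκ0 : 0 < κ := by positivity
  have hκ1 : 2 * κ * (|K| + 1) = 1 := by rw [hκ]; field_simp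
  obtain ⟨V, hV, hVle⟩ :=
    (isInverseOneAdd_graphLaplacian G hG one_ne_zero).exists_inner_le_of_essentialSpectrumPMap_eq_empty
    (by norm_num) (inner_comp_adjoint_symm (formInclusion G 1))
    (fun x => by rw [laplacianResolvent, inner_comp_adjoint_self]; positivity) hess
    (pow_pos hκ0 2)
  obtain ⟨F, hF⟩ := exists_finset_norm_starProjection_le V hκ0
  refine ⟨F, fun w hw => ?_⟩
  have h4 : ‖w.1.fst‖ ≤ 2 * κ * ‖w‖ :=
    norm_apply_le_of_norm_starProjection_le (formInclusion G 1) (norm_formInclusion_le G 1) V hκ0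
      (fun y hy => by
        rw [← inner_comp_adjoint_self]
        exact hVle y hy) w (hF _ hw)
  have h5 : (|K| + 1) * ‖w.1.fst‖ ≤ ‖w‖ := by
    calc (|K| + 1) * ‖w.1.fst‖ ≤ (|K| + 1) * (2 * κ * ‖w‖) := by gcongr
      _ = (2 * κ * (|K| + 1)) * ‖w‖ := by ring
      _ = ‖w‖ := by rw [hκ1, one_mul]
  have h6 : ((|K| + 1) * ‖w.1.fst‖) ^ 2 ≤ ‖w‖ ^ 2 := by gcongr
  have h7 : K ≤ (|K| + 1) ^ 2 := by nlinarith [le_abs_self K, abs_nonneg K]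
  calc K * ‖w.1.fst‖ ^ 2 ≤ (|K| + 1) ^ 2 * ‖w.1.fst‖ ^ 2 := by gcongr
    _ = ((|K| + 1) * ‖w.1.fst‖) ^ 2 := by ring
    _ ≤ _ := h6

end FormSpace

/-! ### Radial test functions and their energy. -/

section TestFunctions

/-- A finitely supported function as an element of `ℓ²`. -/
def lpOfFiniteSupport {ι : Type*} (g : ι → ℝ) (F : Finset ι) (hF : ∀ i ∉ F, g i = 0) :
    lp (fun _ : ι => ℝ) 2 :=
  ⟨g, (memℓp_zero (F.finite_toSet.subset fun i hi => by
    by_contra h; exact hi (hF i h))).of_exponent_ge zero_le⟩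

theorem lpOfFiniteSupport_apply {ι : Type*} (g : ι → ℝ) (F : Finset ι) (hF : ∀ i ∉ F, g i = 0)
    (i : ι) : lpOfFiniteSupport g F hF i = g i := rfl

theorem norm_sq_lpOfFiniteSupport {ι : Type*} (g : ι → ℝ) (F : Finset ι)
    (hF : ∀ i ∉ F, g i = 0) : ‖lpOfFiniteSupport g F hF‖ ^ 2 = ∑ i ∈ F, g i ^ 2 := by
  rw [← real_inner_self_eq_norm_sq, lp.inner_eq_tsum, tsum_eq_sum (s := F)]
  · refine Finset.sum_congr rfl fun i _ => ?_
    rw [real_inner_self_eq_norm_sq, Real.norm_eq_abs, sq_abs]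
    rfl
  · intro i hi
    rw [lpOfFiniteSupport_apply, hF i hi, inner_zero_left]

variable {X : Type*} (G : SimpleGraph X) (N : X → ℕ)

theorem card_filter_eq_ncard {b n : ℕ} (hfin : {x | N x ≤ b}.Finite) (hn : n ≤ b) :
    (hfin.toFinset.filter fun x => N x = n).card = {x | N x = n}.ncard := by
  rw [← Set.ncard_coe_finset]
  congr 1
  ext x
  simp only [Finset.coe_filter, Set.Finite.mem_toFinset, Set.mem_ofPred_eq]
  constructor
  · exact fun h => h.2
  · exact fun h => ⟨h.le.trans hn, h⟩

theorem sum_ncard_fiber {b : ℕ} (hfin : {x | N x ≤ b}.Finite) :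
    ∑ n ∈ Finset.range (b + 1), {x | N x = n}.ncard = {x | N x ≤ b}.ncard := by
  rw [Set.ncard_eq_toFinset_card _ hfin,
    Finset.card_eq_sum_card_fiberwise (f := N) (t := Finset.range (b + 1))]
  · exact Finset.sum_congr rfl fun n hn =>
      (card_filter_eq_ncard N hfin (Nat.lt_succ_iff.1 (Finset.mem_range.1 hn))).symm
  · intro x hx
    simp only [Set.Finite.coe_toFinset, Set.mem_ofPred_eq] at hx
    simpa [Nat.lt_succ_iff] using hx

open scoped Classical in
/-- Bound for the gradient of a function which is radial with respect to `N`. -/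
theorem sum_gradient_sq_le (hN : ∀ x y, G.Adj x y → N y ≤ N x + 1) (f : ℕ → ℝ) {b : ℕ}
    (hfin : {x | N x ≤ b}.Finite) :
    ∑ p ∈ hfin.toFinset ×ˢ hfin.toFinset,
        (if G.Adj p.1 p.2 then f (N p.1) - f (N p.2) else 0) ^ 2 ≤
      2 * ∑ n ∈ Finset.range b, ({x | N x = n}.ncard : ℝ) * ({x | N x = n + 1}.ncard : ℝ) *
        (f n - f (n + 1)) ^ 2 := by
  set F := hfin.toFinset with hFdef
  -- Only edges between consecutive levels contribute. They are later overcounted by all pairs of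
  -- vertices on the two levels, in both orientations.
  have h1 : ∀ p ∈ F ×ˢ F, (if G.Adj p.1 p.2 then f (N p.1) - f (N p.2) else 0) ^ 2 ≤
      ∑ n ∈ Finset.range b, ((if N p.1 = n ∧ N p.2 = n + 1 then (f n - f (n + 1)) ^ 2 else 0) +
        (if N p.1 = n + 1 ∧ N p.2 = n then (f n - f (n + 1)) ^ 2 else 0)) := by
    rintro ⟨x, y⟩ hp
    simp only [hFdef, Finset.mem_product, Set.Finite.mem_toFinset, Set.mem_ofPred_eq] at hp ⊢
    have hnn : ∀ n ∈ Finset.range b,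
        0 ≤ (if N x = n ∧ N y = n + 1 then (f n - f (n + 1)) ^ 2 else 0) +
        (if N x = n + 1 ∧ N y = n then (f n - f (n + 1)) ^ 2 else 0) := by
      intro n _
      split_ifs <;> positivity
    by_cases hadj : G.Adj x y
    · rw [if_pos hadj]
      have h2 := hN x y hadj
      have h3 := hN y x hadj.symm
      rcases lt_trichotomy (N x) (N y) with h | h | h
      · have hy : N y = N x + 1 := by omega
        refine le_trans ?_ (Finset.single_le_sum hnn (Finset.mem_range.2 (show N x < b by omega)))
        rw [if_pos ⟨rfl, hy⟩, hy]
        split_ifs <;> simp [sq_nonneg]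
      · rw [show f (N x) - f (N y) = 0 by rw [h, sub_self], zero_pow two_ne_zero]
        exact Finset.sum_nonneg hnn
      · have hy : N x = N y + 1 := by omega
        refine le_trans ?_ (Finset.single_le_sum hnn (Finset.mem_range.2 (show N y < b by omega)))
        rw [if_neg (by omega), if_pos ⟨hy, rfl⟩, hy]
        linarith [sq_nonneg (f (N y) - f (N y + 1)), sq_abs (f (N y) - f (N y + 1)),
          sub_sq (f (N y)) (f (N y + 1)), sub_sq (f (N y + 1)) (f (N y))]
    · rw [if_neg hadj]
      simpa using Finset.sum_nonneg hnn
  refine (Finset.sum_le_sum h1).trans ?_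
  rw [Finset.sum_comm, Finset.mul_sum]
  refine Finset.sum_le_sum fun n hn => ?_
  have hnb : n + 1 ≤ b := Finset.mem_range.1 hn
  rw [Finset.sum_add_distrib]
  have hcount : ∀ k l : ℕ, k ≤ b → l ≤ b → ∀ a : ℝ,
      ∑ p ∈ F ×ˢ F, (if N p.1 = k ∧ N p.2 = l then a else 0) =
        ({x | N x = k}.ncard : ℝ) * ({x | N x = l}.ncard : ℝ) * a := by
    intro k l hk hl a
    rw [← Finset.sum_filter, Finset.sum_const, nsmul_eq_mul,
      Finset.filter_product (fun x => N x = k) (fun x => N x = l), Finset.card_product,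
      card_filter_eq_ncard N hfin hk, card_filter_eq_ncard N hfin hl]
    push_cast
    ring
  rw [hcount n (n + 1) (by omega) hnb, hcount (n + 1) n hnb (by omega)]
  apply le_of_eq
  ring

theorem exists_formSpace_radial (hN : ∀ x y, G.Adj x y → N y ≤ N x + 1)
    (f : ℕ → ℝ) {b : ℕ} (hf : ∀ n, b ≤ n → f n = 0) (hfin : {x | N x ≤ b}.Finite) :
    ∃ w : formSpace G 1, (∀ x, w.1.fst x = f (N x)) ∧
      ‖w.1.fst‖ ^ 2 = ∑ x ∈ hfin.toFinset, f (N x) ^ 2 ∧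
      ‖w.1.snd‖ ^ 2 ≤ 2 * ∑ n ∈ Finset.range b, ({x | N x = n}.ncard : ℝ) *
        ({x | N x = n + 1}.ncard : ℝ) * (f n - f (n + 1)) ^ 2 := by
  classical
  have h1 : ∀ x ∉ hfin.toFinset, f (N x) = 0 := fun x hx => by
    simp only [Set.Finite.mem_toFinset, Set.mem_ofPred_eq, not_le] at hx
    exact hf _ hx.le
  have h2 : ∀ p ∉ hfin.toFinset ×ˢ hfin.toFinset,
      (if G.Adj p.1 p.2 then f (N p.1) - f (N p.2) else 0) = 0 := by
    rintro ⟨x, y⟩ hp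
    simp only [Finset.mem_product, Set.Finite.mem_toFinset, Set.mem_ofPred_eq] at hp ⊢
    by_cases hadj : G.Adj x y
    · have h3 := hN x y hadj
      have h4 := hN y x hadj.symm
      rw [if_pos hadj, hf (N x) (by omega), hf (N y) (by omega), sub_zero]
    · rw [if_neg hadj]
  refine ⟨⟨WithLp.toLp 2 (lpOfFiniteSupport _ _ h1, lpOfFiniteSupport _ _ h2), fun x y => ?_⟩,
    fun x => rfl, norm_sq_lpOfFiniteSupport _ _ h1, ?_⟩
  · change (if G.Adj x y then f (N x) - f (N y) else 0) =
      if G.Adj x y then 1 * (f (N x) - f (N y)) else 0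
    rw [one_mul]
  · exact (norm_sq_lpOfFiniteSupport _ _ h2).trans_le (sum_gradient_sq_le G N hN f hfin)

/-- A cutoff profile which decreases only at radii where two consecutive spheres are small. -/
theorem exists_cutoff (s : ℕ → ℝ) (hs : ∀ n, 0 ≤ s n) {a m : ℕ} (hma : m < a) {V : ℝ}
    (hV : ∑ n ∈ Finset.range (2 * a + 1), s n ≤ V) :
    ∃ f : ℕ → ℝ, (∀ n ≤ m, f n = 0) ∧ (∀ n, 2 * a ≤ n → f n = 0) ∧
      (∀ n, m < n → n ≤ a → f n = 1) ∧
      ∑ n ∈ Finset.range (2 * a), s n * s (n + 1) * (f n - f (n + 1)) ^ 2 ≤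
        s m * s (m + 1) + 8 * V ^ 2 / (a : ℝ) ^ 3 := by
  classical
  have ha : (0 : ℝ) < a := by exact_mod_cast (Nat.zero_le m).trans_lt hma
  have hV0 : 0 ≤ V := (Finset.sum_nonneg fun n _ => hs n).trans hV
  -- The good radii. The sums `s n + s (n + 1)` total at most `2 * V`, so at most `a / 2` of the `a`
  -- radii are bad; `V = 0` is separate because the count divides by `V`.
  set g := (Finset.Ico a (2 * a)).filter fun n => s n + s (n + 1) ≤ 4 * V / a with hg
  have hgcard : (a : ℝ) / 2 ≤ g.card := by
    rcases hV0.eq_or_lt with h0 | h0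
    · have : g = Finset.Ico a (2 * a) := by
        rw [hg, Finset.filter_true_of_mem]
        intro n hn
        rw [Finset.mem_Ico] at hn
        have hz : ∀ k ∈ Finset.range (2 * a + 1), s k = 0 :=
          (Finset.sum_eq_zero_iff_of_nonneg fun n _ => hs n).1
            (le_antisymm (hV.trans h0.symm.le) (Finset.sum_nonneg fun n _ => hs n))
        rw [hz n (Finset.mem_range.2 (by omega)), hz (n + 1) (Finset.mem_range.2 (by omega)), ← h0]
        simp
      rw [this, Nat.card_Ico, show 2 * a - a = a by omega]
      linarith
    · set B := (Finset.Ico a (2 * a)).filter fun n => ¬ (s n + s (n + 1) ≤ 4 * V / a) with hB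
      have hcard : g.card + B.card = a := by
        rw [hg, hB, Finset.card_filter_add_card_filter_not, Nat.card_Ico]; omega
      have h1 : (B.card : ℝ) * (4 * V / a) ≤ 2 * V := by
        calc (B.card : ℝ) * (4 * V / a) = ∑ n ∈ B, 4 * V / a := by
              rw [Finset.sum_const, nsmul_eq_mul]
          _ ≤ ∑ n ∈ B, (s n + s (n + 1)) := Finset.sum_le_sum fun n hn => by
              have := (Finset.mem_filter.1 hn).2
              linarith
          _ ≤ ∑ n ∈ Finset.range (2 * a), (s n + s (n + 1)) := by
              refine Finset.sum_le_sum_of_subset_of_nonneg (fun n hn => ?_)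
                fun n _ _ => add_nonneg (hs _) (hs _)
              have := Finset.mem_Ico.1 (Finset.mem_filter.1 hn).1
              exact Finset.mem_range.2 this.2
          _ ≤ 2 * V := by
              rw [Finset.sum_add_distrib]
              have h2 := hV
              have h3 := hV
              rw [Finset.sum_range_succ] at h2
              rw [Finset.sum_range_succ'] at h3
              linarith [hs 0, hs (2 * a)]
      have h2 : (B.card : ℝ) ≤ a / 2 := by
        rw [mul_div_assoc', div_le_iff₀ ha] at h1
        have : (4 * V) * (B.card : ℝ) ≤ (4 * V) * (a / 2) := by linarith
        exact le_of_mul_le_mul_left this (by linarith)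
      have h3 : (g.card : ℝ) + B.card = a := by exact_mod_cast hcard
      linarith
  have hg0 : (0 : ℝ) < g.card := by linarith
  -- The fraction of good radii that are at least `n`: it drops by `1 / g.card` at each good radius
  -- and nowhere else.
  set h : ℕ → ℝ := fun n => ((g.filter fun k => n ≤ k).card : ℝ) / g.card with hh
  have hle : ∀ n ≤ a, h n = 1 := fun n hn => by
    have : (g.filter fun k => n ≤ k) = g := Finset.filter_true_of_mem fun k hk => by
      have := Finset.mem_Ico.1 (Finset.mem_filter.1 hk).1
      omega
    simp only [hh, this]
    exact div_self hg0.ne'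
  have hge : ∀ n, 2 * a ≤ n → h n = 0 := fun n hn => by
    have : (g.filter fun k => n ≤ k) = ∅ := Finset.filter_false_of_mem fun k hk => by
      have := Finset.mem_Ico.1 (Finset.mem_filter.1 hk).1
      omega
    simp only [hh, this]
    simp
  have hstep : ∀ n, h n - h (n + 1) = if n ∈ g then 1 / (g.card : ℝ) else 0 := fun n => by
    have h1 : (g.filter fun k => n ≤ k).card =
        (g.filter fun k => n + 1 ≤ k).card + if n ∈ g then 1 else 0 := by
      rw [← Finset.card_filter_add_card_filter_not (s := g.filter fun k => n ≤ k)
        (fun k => n + 1 ≤ k)]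
      congr 1
      · congr 1
        rw [Finset.filter_filter]
        exact Finset.filter_congr fun k _ => by omega
      · have : ((g.filter fun k => n ≤ k).filter fun k => ¬ (n + 1 ≤ k)) =
            g.filter fun k => k = n := by
          rw [Finset.filter_filter]
          exact Finset.filter_congr fun k _ => by omega
        rw [this, Finset.filter_eq']
        split_ifs <;> simp
    simp only [hh, h1]
    split_ifs <;> push_cast <;> ring
  -- Vanishing up to `m` creates one unit jump from `m` to `m + 1`, the source of the term `s m * s
  -- (m + 1)`.
  refine ⟨fun n => if n ≤ m then 0 else h n, fun n hn => if_pos hn, fun n hn => ?_,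
    fun n hn hna => ?_, ?_⟩
  · exact (if_neg (by omega)).trans (hge n hn)
  · exact (if_neg (by omega)).trans (hle n hna)
  have hterm : ∀ n ∈ Finset.range (2 * a),
      s n * s (n + 1) * ((if n ≤ m then 0 else h n) - (if n + 1 ≤ m then 0 else h (n + 1))) ^ 2 ≤
        (if n = m then s m * s (m + 1) else 0) +
          if n ∈ g then 4 * V ^ 2 / a ^ 2 / (g.card : ℝ) ^ 2 else 0 := by
    intro n _
    have hnn : 0 ≤ if n ∈ g then 4 * V ^ 2 / a ^ 2 / (g.card : ℝ) ^ 2 else 0 := by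
      split_ifs <;> positivity
    rcases lt_trichotomy n m with hn | rfl | hn
    · rw [if_pos hn.le, if_pos (show n + 1 ≤ m from hn), if_neg hn.ne]
      simpa using hnn
    · rw [if_pos le_rfl, if_neg (by omega), if_pos rfl, hle _ (show n + 1 ≤ a from hma)]
      norm_num
      exact hnn
    · rw [if_neg (by omega), if_neg (by omega), if_neg hn.ne', hstep, zero_add]
      split_ifs with hng
      · have h1 : s n + s (n + 1) ≤ 4 * V / a := (Finset.mem_filter.1 hng).2
        have h2 : s n * s (n + 1) ≤ 4 * V ^ 2 / a ^ 2 := by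
          have h3 : (s n + s (n + 1)) ^ 2 ≤ (4 * V / a) ^ 2 := by
            have := hs n
            have := hs (n + 1)
            gcongr
          have h4 : (4 * V / a) ^ 2 = 4 * (4 * V ^ 2 / a ^ 2) := by ring
          nlinarith [sq_nonneg (s n - s (n + 1))]
        calc _ ≤ 4 * V ^ 2 / a ^ 2 * (1 / (g.card : ℝ)) ^ 2 := by gcongr
          _ = _ := by ring
      · simp
  refine (Finset.sum_le_sum hterm).trans ?_
  rw [Finset.sum_add_distrib, Finset.sum_ite_eq' (Finset.range (2 * a)),
    if_pos (Finset.mem_range.2 (by omega)), ← Finset.sum_filter, Finset.filter_mem_eq_inter,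
    Finset.inter_eq_right.2 (fun n hn => by
      have := Finset.mem_Ico.1 (Finset.mem_filter.1 hn).1
      exact Finset.mem_range.2 this.2), Finset.sum_const, nsmul_eq_mul]
  gcongr
  have h1 : (g.card : ℝ) * (4 * V ^ 2 / a ^ 2 / (g.card : ℝ) ^ 2) =
      4 * V ^ 2 / a ^ 2 / g.card := by field_simp
  rw [h1]
  calc 4 * V ^ 2 / (a : ℝ) ^ 2 / g.card ≤ 4 * V ^ 2 / (a : ℝ) ^ 2 / (a / 2) := by gcongr
    _ = _ := by field_simp; ring

/-- Test functions supported on a large annulus. -/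
theorem exists_formSpace_annulus (hN : ∀ x y, G.Adj x y → N y ≤ N x + 1)
    (hfin : ∀ n, {x | N x ≤ n}.Finite) {a m : ℕ} (hma : m < a) :
    ∃ w : formSpace G 1, (∀ x, N x ≤ m → w.1.fst x = 0) ∧
      ({x | N x ≤ a}.ncard : ℝ) - {x | N x ≤ m}.ncard ≤ ‖w.1.fst‖ ^ 2 ∧
      ‖w.1.snd‖ ^ 2 ≤ 2 * ({x | N x = m}.ncard * {x | N x = m + 1}.ncard) +
        16 * ({x | N x ≤ 2 * a}.ncard : ℝ) ^ 2 / (a : ℝ) ^ 3 := by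
  classical
  obtain ⟨f, hf0, hf2, hf1, hfe⟩ := exists_cutoff (fun n => ({x | N x = n}.ncard : ℝ))
    (fun n => by positivity) hma (V := ({x | N x ≤ 2 * a}.ncard : ℝ))
    (by rw [← sum_ncard_fiber N (hfin (2 * a))]; push_cast; exact le_rfl)
  obtain ⟨w, hw, hw1, hw2⟩ := exists_formSpace_radial G N hN f hf2 (hfin (2 * a))
  refine ⟨w, fun x hx => by rw [hw, hf0 _ hx], ?_, ?_⟩
  · rw [hw1]
    have hsub : (hfin m).toFinset ⊆ (hfin a).toFinset := fun x hx => by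
      simp only [Set.Finite.mem_toFinset, Set.mem_ofPred_eq] at hx ⊢
      omega
    have h1 : ({x | N x ≤ a}.ncard : ℝ) - {x | N x ≤ m}.ncard =
        ∑ x ∈ (hfin a).toFinset \ (hfin m).toFinset, f (N x) ^ 2 := by
      have : ∀ x ∈ (hfin a).toFinset \ (hfin m).toFinset, f (N x) ^ 2 = 1 := fun x hx => by
        simp only [Finset.mem_sdiff, Set.Finite.mem_toFinset, Set.mem_ofPred_eq, not_le] at hx
        rw [hf1 _ hx.2 hx.1, one_pow]
      rw [Finset.sum_congr rfl this, Finset.sum_const, nsmul_eq_mul, mul_one,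
        Finset.cast_card_sdiff hsub, Set.ncard_eq_toFinset_card _ (hfin a),
        Set.ncard_eq_toFinset_card _ (hfin m)]
    rw [h1]
    refine Finset.sum_le_sum_of_subset_of_nonneg (fun x hx => ?_) fun _ _ _ => sq_nonneg _
    simp only [Finset.mem_sdiff, Set.Finite.mem_toFinset, Set.mem_ofPred_eq] at hx ⊢
    omega
  · refine hw2.trans ((mul_le_mul_of_nonneg_left hfe zero_le_two).trans_eq ?_)
    ring

end TestFunctions

/-! ### Growth of sequences under a Poincaré type inequality. -/

section VolumeGrowth

/-- For `u(n) = v(n) / n³` the hypothesis reads `κ u(a) ≤ 64 u(2a)²`, so a lower bound `c ≤ κ / 64`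
passes from `a` to `2a`. Monotonicity fills in between dyadic radii at the cost of a factor 8. -/
theorem exists_pow_three_le_of_doubling {v : ℕ → ℝ} (hmono : Monotone v) {κ : ℝ} (hκ : 0 < κ)
    {a₁ : ℕ} (ha₁ : 0 < a₁) (hv : 0 < v a₁)
    (h : ∀ a, a₁ ≤ a → κ * v a * (a : ℝ) ^ 3 ≤ v (2 * a) ^ 2) :
    ∃ c > 0, ∀ n, a₁ ≤ n → c * (n : ℝ) ^ 3 ≤ v n := by
  have ha : (0 : ℝ) < a₁ := by exact_mod_cast ha₁
  have hpos : ∀ n, a₁ ≤ n → 0 < v n := fun n hn => hv.trans_le (hmono hn)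
  set c := min (κ / 64) (v a₁ / (a₁ : ℝ) ^ 3) with hc
  have hc0 : 0 < c := by positivity
  have hdy : ∀ k : ℕ, c * ((2 ^ k * a₁ : ℕ) : ℝ) ^ 3 ≤ v (2 ^ k * a₁) := by
    intro k
    induction k with
    | zero =>
      rw [pow_zero, one_mul, ← le_div_iff₀ (by positivity)]
      exact min_le_right _ _
    | succ k ih =>
      have hle : a₁ ≤ 2 ^ k * a₁ := Nat.le_mul_of_pos_left _ (by positivity)
      have h1 := h _ hle
      rw [pow_succ 2, mul_comm (2 ^ k) 2, mul_assoc]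
      set n := 2 ^ k * a₁
      have hn : (0 : ℝ) < n := by exact_mod_cast ha₁.trans_le hle
      have h2 : c * 64 ≤ κ := by
        rw [← le_div_iff₀ (by norm_num)]; exact min_le_left _ _
      refine le_of_sq_le_sq (le_trans ?_ h1) (hpos _ (by omega)).le
      push_cast
      calc (c * (2 * (n : ℝ)) ^ 3) ^ 2 = (c * 64) * (c * (n : ℝ) ^ 3) * (n : ℝ) ^ 3 := by ring
        _ ≤ κ * v n * (n : ℝ) ^ 3 := by gcongr
  refine ⟨c / 8, by positivity, fun n hn => ?_⟩
  have hq : n / a₁ ≠ 0 := (Nat.div_pos hn ha₁).ne'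
  set k := Nat.log 2 (n / a₁) with hk
  have h1 : 2 ^ k * a₁ ≤ n := by
    have := Nat.pow_log_le_self 2 hq
    exact (Nat.mul_le_mul_right _ this).trans (Nat.div_mul_le_self n a₁)
  have h2 : n < 2 ^ (k + 1) * a₁ :=
    (Nat.div_lt_iff_lt_mul ha₁).1 (Nat.lt_pow_succ_log_self one_lt_two _)
  have h3 : (n : ℝ) ≤ 2 * ((2 ^ k * a₁ : ℕ) : ℝ) := by
    have : (n : ℝ) ≤ ((2 ^ (k + 1) * a₁ : ℕ) : ℝ) := by exact_mod_cast h2.le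
    refine this.trans_eq ?_
    push_cast; ring
  calc c / 8 * (n : ℝ) ^ 3 ≤ c / 8 * (2 * ((2 ^ k * a₁ : ℕ) : ℝ)) ^ 3 := by gcongr
    _ = c * ((2 ^ k * a₁ : ℕ) : ℝ) ^ 3 := by ring
    _ ≤ v (2 ^ k * a₁) := hdy k
    _ ≤ v n := hmono h1

/-- A Poincaré type inequality forces at least cubic growth. -/
theorem exists_pow_three_le_of_poincare {v : ℕ → ℝ} (hmono : Monotone v)
    (hv : Tendsto v atTop atTop) {lam C : ℝ} (hlam : 0 < lam) {m : ℕ}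
    (h : ∀ a, m < a → lam * (v a - v m) ≤ C + 16 * v (2 * a) ^ 2 / (a : ℝ) ^ 3) :
    ∃ c > 0, ∃ n₀ : ℕ, ∀ n, n₀ ≤ n → c * (n : ℝ) ^ 3 ≤ v n := by
  -- Beyond `a₁` the constant `C + lam * v m` is absorbed by half of `lam * v a`.
  obtain ⟨a₁, ha₁⟩ := ((hv.eventually_ge_atTop (2 * (C / lam + v m))).and
    ((hv.eventually_gt_atTop 0).and (eventually_gt_atTop m))).exists_forall_of_atTop
  have hm1 : m < a₁ := (ha₁ a₁ le_rfl).2.2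
  obtain ⟨c, hc, hcv⟩ := exists_pow_three_le_of_doubling hmono (κ := lam / 32) (by positivity)
    (show 0 < a₁ by omega) (ha₁ a₁ le_rfl).2.1 (fun a ha => by
      obtain ⟨h1, h2, h3⟩ := ha₁ a ha
      have h4 := h a h3
      have ha0 : (0 : ℝ) < a := by exact_mod_cast (Nat.zero_le m).trans_lt h3
      have h5 : C + lam * v m ≤ lam / 2 * v a := by
        have := mul_le_mul_of_nonneg_left h1 hlam.le
        have h6 : lam * (2 * (C / lam + v m)) = 2 * (C + lam * v m) := by field_simp
        rw [h6] at this
        linarith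
      have h6 : lam / 2 * v a ≤ 16 * v (2 * a) ^ 2 / (a : ℝ) ^ 3 := by linarith
      rw [le_div_iff₀ (by positivity)] at h6
      linarith)
  exact ⟨c, hc, a₁, hcv⟩

/-- At most cubic growth bounds the constant in a Poincaré type inequality. -/
theorem not_poincare_of_le_pow_three {v : ℕ → ℝ}
    (hv : Tendsto v atTop atTop) {lam C C₀ : ℝ} (hC₀ : 0 < C₀)
    (hle : ∀ᶠ n : ℕ in atTop, v n ≤ C₀ * (n : ℝ) ^ 3) (hlam : 2304 * C₀ ≤ lam) {m : ℕ}
    (h : ∀ a, m < a → lam * (v a - v m) ≤ C + 16 * v (2 * a) ^ 2 / (a : ℝ) ^ 3) : False := by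
  have hlam0 : 0 < lam := by linarith
  obtain ⟨a₁, ha₁⟩ := ((hv.eventually_ge_atTop (2 * (C / lam + v m))).and
    ((hv.eventually_gt_atTop 0).and ((eventually_gt_atTop m).and hle))).exists_forall_of_atTop
  -- Here `lam / 2 * v a ≤ 128 * C₀ * v (2 * a)`, and `2304 = 9 * 256`; any factor above 8 would
  -- contradict cubic growth.
  have hdouble : ∀ a, a₁ ≤ a → 9 * v a ≤ v (2 * a) := by
    intro a ha
    obtain ⟨h1, h2, h3, -⟩ := ha₁ a ha
    obtain ⟨-, h2', -, h8⟩ := ha₁ (2 * a) (by omega)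
    have h4 := h a h3
    have ha0 : (0 : ℝ) < a := by exact_mod_cast (Nat.zero_le m).trans_lt h3
    have h5 : C + lam * v m ≤ lam / 2 * v a := by
      have := mul_le_mul_of_nonneg_left h1 hlam0.le
      have h6 : lam * (2 * (C / lam + v m)) = 2 * (C + lam * v m) := by field_simp
      rw [h6] at this
      linarith
    have h6 : 16 * v (2 * a) ^ 2 / (a : ℝ) ^ 3 ≤ 128 * C₀ * v (2 * a) := by
      rw [div_le_iff₀ (by positivity)]
      push_cast at h8
      calc 16 * v (2 * a) ^ 2 = 16 * v (2 * a) * v (2 * a) := by ring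
        _ ≤ 16 * v (2 * a) * (C₀ * (2 * (a : ℝ)) ^ 3) := by gcongr
        _ = _ := by ring
    have h7 : 2304 * C₀ / 2 * v a ≤ lam / 2 * v a := by gcongr
    have h9 : C₀ * (9 * v a) ≤ C₀ * v (2 * a) := by linarith
    exact le_of_mul_le_mul_left h9 hC₀
  have hpow : ∀ k : ℕ, 9 ^ k * v a₁ ≤ v (2 ^ k * a₁) := by
    intro k
    induction k with
    | zero => simp
    | succ k ih =>
      have := hdouble (2 ^ k * a₁) (Nat.le_mul_of_pos_left _ (by positivity))
      rw [pow_succ 2, mul_comm (2 ^ k) 2, mul_assoc]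
      refine le_trans ?_ this
      rw [pow_succ]
      linarith
  have hv1 : 0 < v a₁ := (ha₁ a₁ le_rfl).2.1
  obtain ⟨k, hk⟩ := pow_unbounded_of_one_lt (C₀ * (a₁ : ℝ) ^ 3 / v a₁)
    (show (1 : ℝ) < 9 / 8 by norm_num)
  have h1 := (ha₁ (2 ^ k * a₁) (Nat.le_mul_of_pos_left _ (by positivity))).2.2.2
  have h2 := hpow k
  rw [div_lt_iff₀ hv1, div_pow, div_mul_eq_mul_div, lt_div_iff₀ (by positivity)] at hk
  push_cast at h1
  have h3 : C₀ * ((2 : ℝ) ^ k * a₁) ^ 3 = C₀ * (a₁ : ℝ) ^ 3 * 8 ^ k := by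
    rw [mul_pow, ← pow_mul, mul_comm k 3, pow_mul]; norm_num; ring
  linarith

end VolumeGrowth

/-! ### Volumes of balls and the two spectral conclusions. -/

section Balls

variable {X : Type*} (G : SimpleGraph X)

theorem dist_le_dist_add_one (hG : G.Connected) (x₀ x y : X) (h : G.Adj x y) :
    G.dist y x₀ ≤ G.dist x x₀ + 1 := by
  have h1 := hG.dist_triangle (u := y) (v := x) (w := x₀)
  rw [SimpleGraph.dist_eq_one_iff_adj.2 h.symm] at h1
  omega

theorem finite_dist_le [G.LocallyFinite] (hG : G.Connected) (x₀ : X) (n : ℕ) :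
    {x | G.dist x x₀ ≤ n}.Finite := by
  classical
  induction n with
  | zero =>
    refine (Set.finite_singleton x₀).subset fun x hx => ?_
    exact hG.dist_eq_zero_iff.1 (Nat.le_zero.1 hx)
  | succ n ih =>
    have hfin : ({x | G.dist x x₀ ≤ n} ∪
        ⋃ y ∈ {x | G.dist x x₀ ≤ n}, (G.neighborFinset y : Set X)).Finite :=
      ih.union (ih.biUnion fun y _ => Finset.finite_toSet _)
    refine hfin.subset fun x hx => ?_
    by_cases hxn : G.dist x x₀ ≤ n
    · exact Or.inl hxn
    right
    obtain ⟨p, hp⟩ := hG.exists_walk_length_eq_dist x x₀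
    cases p with
    | nil => simp at hxn
    | cons h q =>
      rename_i y
      have hx' : G.dist x x₀ ≤ n + 1 := hx
      rw [SimpleGraph.Walk.length_cons] at hp
      have h1 := SimpleGraph.dist_le q
      refine Set.mem_biUnion (show y ∈ {x | G.dist x x₀ ≤ n} from ?_) (by simpa using h.symm)
      change G.dist y x₀ ≤ n
      omega

theorem monotone_ncard_dist_le [G.LocallyFinite] (hG : G.Connected) (x₀ : X) :
    Monotone fun n : ℕ => ({x | G.dist x x₀ ≤ n}.ncard : ℝ) := fun a b hab => by
  refine Nat.cast_le.2 ?_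
  exact Set.ncard_le_ncard (fun x hx => le_trans hx hab) (finite_dist_le G hG x₀ b)

theorem tendsto_ncard_dist_le [Infinite X] [G.LocallyFinite] (hG : G.Connected) (x₀ : X) :
    Tendsto (fun n : ℕ => ({x | G.dist x x₀ ≤ n}.ncard : ℝ)) atTop atTop := by
  refine tendsto_atTop_atTop_of_monotone (monotone_ncard_dist_le G hG x₀) fun b => ?_
  obtain ⟨k, hk⟩ := exists_nat_ge b
  obtain ⟨F, hF⟩ := Infinite.exists_subset_card_eq X k
  refine ⟨F.sup fun x => G.dist x x₀, hk.trans ?_⟩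
  rw [← hF, ← Set.ncard_coe_finset]
  exact_mod_cast Set.ncard_le_ncard (fun x hx => Finset.le_sup (f := fun x => G.dist x x₀) hx)
    (finite_dist_le G hG x₀ _)

theorem graphBall_eq (x₀ : X) {r : ℝ} (hr : 0 ≤ r) :
    graphBall G x₀ r = {x | G.dist x x₀ ≤ ⌊r⌋₊} := by
  ext x
  exact (Nat.le_floor_iff hr).symm

variable [G.LocallyFinite]

/-- A lower bound for the form outside a finite set gives a Poincaré type inequality for the
volumes of balls. -/
theorem poincare_ncard_dist_le (hG : G.Connected) (x₀ : X) {lam : ℝ} (hlam : 0 ≤ lam) {m : ℕ}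
    (h : ∀ w : formSpace G 1, (∀ x, G.dist x x₀ ≤ m → w.1.fst x = 0) →
      lam * ‖w.1.fst‖ ^ 2 ≤ ‖w.1.snd‖ ^ 2) {a : ℕ} (hma : m < a) :
    lam * (({x | G.dist x x₀ ≤ a}.ncard : ℝ) - {x | G.dist x x₀ ≤ m}.ncard) ≤
      2 * ({x | G.dist x x₀ = m}.ncard * {x | G.dist x x₀ = m + 1}.ncard) +
        16 * ({x | G.dist x x₀ ≤ 2 * a}.ncard : ℝ) ^ 2 / (a : ℝ) ^ 3 := by
  obtain ⟨w, hw, h1, h2⟩ := exists_formSpace_annulus G (fun x => G.dist x x₀)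
    (dist_le_dist_add_one G hG x₀) (finite_dist_le G hG x₀) hma
  exact (mul_le_mul_of_nonneg_left h1 hlam).trans ((h w hw).trans h2)

variable [Infinite X]

theorem zero_mem_spectrumPMap_of_liminf_lt (hG : G.Connected) (x₀ : X)
    (hlim : liminf (fun r : ℝ =>
      ((Real.log ((graphBall G x₀ r).ncard : ℝ) / Real.log r : ℝ) : EReal)) atTop < 3) :
    (0 : ℝ) ∈ spectrumPMap (graphLaplacian G) := by
  intro h0
  obtain ⟨lam, hlam, hw⟩ :=
    (isInverseOneAdd_graphLaplacian G hG one_ne_zero).exists_mul_le_of_zero_mem_resolventSetPMap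
      (by norm_num) (norm_formInclusion_le G 1) h0
  have hpo := fun a (ha : 0 < a) => poincare_ncard_dist_le G hG x₀ hlam.le (m := 0)
    (fun w _ => by
      have h1 := hw w
      rw [formSpace_norm_sq] at h1
      rw [← formInclusion_apply]
      linarith) ha
  obtain ⟨c, hc, n₀, hcn⟩ := exists_pow_three_le_of_poincare (monotone_ncard_dist_le G hG x₀)
    (tendsto_ncard_dist_le G hG x₀) hlam hpo
  obtain ⟨q, hq1, hq3⟩ := EReal.lt_iff_exists_real_btwn.1 hlim
  have hq3' : q < 3 := EReal.coe_lt_coe_iff.1 hq3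
  have hfreq := frequently_lt_of_liminf_lt (by isBoundedDefault) hq1
  -- For such `r`, `log (c / 8) + 3 log r` exceeds `q log r`; the 8 comes from `⌊r⌋₊ ≥ r / 2`.
  have hlog : ∀ᶠ r : ℝ in atTop, -Real.log (c / 8) / (3 - q) < Real.log r :=
    Real.tendsto_log_atTop.eventually_gt_atTop _
  obtain ⟨r, hr, hr1, hr2, hr3⟩ := (hfreq.and_eventually
    ((eventually_ge_atTop (n₀ : ℝ)).and ((eventually_gt_atTop 1).and hlog))).exists
  have hr0 : 0 ≤ r := by linarith
  have hlogr : 0 < Real.log r := Real.log_pos hr2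
  have hr' : Real.log ((graphBall G x₀ r).ncard : ℝ) / Real.log r < q := by exact_mod_cast hr
  rw [div_lt_iff₀ hlogr, graphBall_eq G x₀ hr0] at hr'
  have h1 := hcn ⌊r⌋₊ (Nat.le_floor hr1)
  have h2 : r / 2 ≤ (⌊r⌋₊ : ℝ) := by
    have h3 := Nat.lt_floor_add_one r
    have h4 : (1 : ℝ) ≤ (⌊r⌋₊ : ℝ) := by exact_mod_cast Nat.le_floor (by simpa using hr2.le)
    linarith
  have h3 : c / 8 * r ^ 3 ≤ ({x | G.dist x x₀ ≤ ⌊r⌋₊}.ncard : ℝ) := by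
    refine le_trans ?_ h1
    calc c / 8 * r ^ 3 = c * (r / 2) ^ 3 := by ring
      _ ≤ _ := by gcongr
  have h4 := Real.log_le_log (by positivity) h3
  rw [Real.log_mul (by positivity) (by positivity), Real.log_pow] at h4
  rw [div_lt_iff₀ (by linarith)] at hr3
  push_cast at h4
  linarith

theorem essentialSpectrumPMap_nonempty_of_limsup_lt (hG : G.Connected) (x₀ : X)
    (hlim : limsup (fun r : ℝ =>
      ((((graphBall G x₀ r).ncard : ℝ) / r ^ 3 : ℝ) : EReal)) atTop < ⊤) :
    (essentialSpectrumPMap (graphLaplacian G)).Nonempty := by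
  by_contra hne
  rw [Set.not_nonempty_iff_eq_empty] at hne
  obtain ⟨q, hq, -⟩ := EReal.lt_iff_exists_real_btwn.1 hlim
  have hev := eventually_lt_of_limsup_lt hq (by isBoundedDefault)
  set C₀ := max q 1 with hC₀
  have hC₀0 : 0 < C₀ := by positivity
  have hle : ∀ᶠ n : ℕ in atTop, ({x | G.dist x x₀ ≤ n}.ncard : ℝ) ≤ C₀ * (n : ℝ) ^ 3 := by
    filter_upwards [tendsto_natCast_atTop_atTop.eventually hev, eventually_gt_atTop 0] with n hn hn0
    have hn' : ((graphBall G x₀ (n : ℝ)).ncard : ℝ) / (n : ℝ) ^ 3 < q := by exact_mod_cast hn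
    have hn0' : (0 : ℝ) < n := by exact_mod_cast hn0
    rw [graphBall_eq G x₀ hn0'.le, Nat.floor_natCast, div_lt_iff₀ (by positivity)] at hn'
    refine hn'.le.trans ?_
    gcongr
    exact le_max_left _ _
  -- The extra 1 pays for the `ℓ²` part of the form norm, leaving `2304 * C₀` for the gradient.
  obtain ⟨F, hF⟩ := exists_finset_mul_norm_sq_le G hG hne (2304 * C₀ + 1)
  have hpo := fun a (ha : (F.sup fun x => G.dist x x₀) < a) =>
    poincare_ncard_dist_le G hG x₀ (lam := 2304 * C₀) (by positivity)
      (m := F.sup fun x => G.dist x x₀)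
      (fun w hw => by
        have h1 := hF w fun x hx => hw x (Finset.le_sup (f := fun x => G.dist x x₀) hx)
        rw [formSpace_norm_sq, formInclusion_apply] at h1
        linarith) ha
  exact not_poincare_of_le_pow_three (tendsto_ncard_dist_le G hG x₀) hC₀0 hle le_rfl hpo

theorem sInf_image_eq_zero_of_subset_spectrumPMap (hG : G.Connected) {A : Set ℝ}
    (hA : A ⊆ spectrumPMap (graphLaplacian G)) (h0 : (0 : ℝ) ∈ A) :
    sInf ((fun l : ℝ => (l : EReal)) '' A) = 0 := by
  refine le_antisymm (sInf_le ⟨0, h0, rfl⟩) (le_sInf ?_)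
  rintro _ ⟨l, hl, rfl⟩
  have : 0 ≤ l := by
    by_contra! hlt
    exact hA hl (mem_resolventSetPMap_of_neg G hG hlt)
  exact EReal.coe_nonneg.2 this

end Balls

end

theorem theorem4 {X : Type*} [Infinite X] (G : SimpleGraph X) [G.LocallyFinite]
    (hG : G.Connected) (x₀ : X) :
    (liminf (fun r : ℝ =>
        ((Real.log ((graphBall G x₀ r).ncard : ℝ) / Real.log r : ℝ) : EReal)) atTop < 3 →
      bottomSpectrum (graphLaplacian G) = 0 ∧ bottomEssentialSpectrum (graphLaplacian G) = 0) ∧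
    (limsup (fun r : ℝ =>
        ((((graphBall G x₀ r).ncard : ℝ) / r ^ 3 : ℝ) : EReal)) atTop < ⊤ →
      bottomEssentialSpectrum (graphLaplacian G) < ⊤ ∧
        (essentialSpectrumPMap (graphLaplacian G)).Nonempty) := by
  refine ⟨fun h => ?_, fun h => ?_⟩
  · have h0 := zero_mem_spectrumPMap_of_liminf_lt G hG x₀ h
    exact ⟨sInf_image_eq_zero_of_subset_spectrumPMap G hG le_rfl h0,
      sInf_image_eq_zero_of_subset_spectrumPMap G hG Set.sdiff_subset
        ⟨h0, zero_notMem_discreteSpectrumPMap G hG⟩⟩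
  · obtain ⟨l, hl⟩ := essentialSpectrumPMap_nonempty_of_limsup_lt G hG x₀ h
    exact ⟨(sInf_le (Set.mem_image_of_mem _ hl)).trans_lt (EReal.coe_lt_top l), l, hl⟩
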